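/- Let $D\subset\mathbb C$ be an open, connected and simply connected set that is symmetric with respect to the real axis, with $[-1,1]\subset D$ and $D\neq\mathbb C$, and put $$\delta_D=\sup_{x\in[-1,1]}\ \inf_{z\in\mathbb C\setminus D}|x-z| .$$ For points $-1\le x_1<\dots<x_n\le 1$ and positive integers $k_1,\dots,k_n$, let $\mathcal F_+(D;(x_j);(k_j))$ be the set of holomorphic functions $f$ from $D$ to the open unit disc such that $f^{(l)}(x_j)=0$ for $l=0,\dots,k_j-1$ and $j=1,\dots,n$, and such that $f$ is real and nonnegative on $D\cap\mathbb R$. Put $$J_+(D;(x_j);(k_j))=\sup\Bigl\{\Bigl|\int_{-1}^1 g(x)\,dx\Bigr| : g\in\mathcal F_+(D;(x_j);(k_j))\Bigr\}$$ and, for a positive integer $N$, $$J_+(D;N)=\inf\bigl\{J_+(D;(x_j)_{j=1}^n;(k_j)_{j=1}^n) : n\in\mathbb N,\ -1\le x_1<\dots<x_n\le1,\ k_j\ge 1,\ k_1+\dots+k_n=N\bigr\}.$$ Then for every positive integer $N$, $$J_+(D;N)\ \ge\ 2L^{2N}\,\frac{\delta_D^{\,2N\delta_D/L}}{(\delta_D+L)^{(2N/L)(\delta_D+L)}}$$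 with $L=1/4$, and, if $D$ is convex, also with $L=1/2$. If $D$ is convex, then moreover $$J_+(D;N)\ \ge\ 2\Bigl(\bigl(1+\tfrac1{2\delta_D}\bigr)^{2\delta_D}(2\delta_D+1)\Bigr)^{-2N}\ \ge\ 2e^{-2N}(2\delta_D+1)^{-2N}.$$ -/

import Mathlib

open MeasureTheory Set

noncomputable section

/-- A nice domain: an open, connected, simply connected subset of `ℂ` that is symmetric with
respect to the real axis.  (`IsSimplyConnected` includes path-connectedness and nonemptiness.) -/
structure IsNiceDomain (D : Set ℂ) : Prop where
  isOpen : IsOpen D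
  isSimplyConnected : IsSimplyConnected D
  conj_mem : ∀ z ∈ D, starRingEnd ℂ z ∈ D

/-- `𝓕(D; X; 𝓚)`: the holomorphic maps of `D` into the open unit disc all of whose derivatives of
order `0, …, k j - 1` vanish at `x j`.  A map on `D` is represented by a function on `ℂ`; only its
values on `D` matter. -/
def holFamily (D : Set ℂ) {n : ℕ} (x : Fin n → ℝ) (k : Fin n → ℕ) : Set (ℂ → ℂ) :=
  {f | DifferentiableOn ℂ f D ∧ MapsTo f D (Metric.ball 0 1) ∧
    ∀ j, ∀ l < k j, iteratedDeriv l f (x j : ℂ) = 0}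

/-- `𝓕_r(D; X; 𝓚)`: the members of `𝓕(D; X; 𝓚)` that are real on `D ∩ ℝ`. -/
def realFamily (D : Set ℂ) {n : ℕ} (x : Fin n → ℝ) (k : Fin n → ℕ) : Set (ℂ → ℂ) :=
  {f | f ∈ holFamily D x k ∧ ∀ t : ℝ, (t : ℂ) ∈ D → (f t).im = 0}

/-- `𝓕₊(D; X; 𝓚)`: the members of `𝓕_r(D; X; 𝓚)` that are nonnegative on `D ∩ ℝ`. -/
def posFamily (D : Set ℂ) {n : ℕ} (x : Fin n → ℝ) (k : Fin n → ℕ) : Set (ℂ → ℂ) :=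
  {f | f ∈ realFamily D x k ∧ ∀ t : ℝ, (t : ℂ) ∈ D → 0 ≤ (f t).re}

/-- `J₊(D; X; 𝓚)` for the measure `α` on `[-1, 1]`: the supremum of `|∫_{-1}^1 g dα|` over
`g ∈ 𝓕₊(D; X; 𝓚)`.  The set is nonempty (`g = 0`) and bounded above by `α [-1, 1]`. -/
def jPlusNodes (α : Measure ℝ) (D : Set ℂ) {n : ℕ} (x : Fin n → ℝ) (k : Fin n → ℕ) : ℝ :=
  sSup ((fun g : ℂ → ℂ => ‖∫ t in Icc (-1 : ℝ) 1, g (t : ℂ) ∂α‖) '' posFamily D x k)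

/-- `J₊(D; N)` for the measure `α` on `[-1, 1]`: the infimum of `J₊(D; X; 𝓚)` over all `n`, all
nodes `-1 ≤ x₁ < ⋯ < xₙ ≤ 1` and all positive multiplicities with `k₁ + ⋯ + kₙ = N`. -/
def jPlus (α : Measure ℝ) (D : Set ℂ) (N : ℕ) : ℝ :=
  sInf {J : ℝ | ∃ (n : ℕ) (x : Fin n → ℝ) (k : Fin n → ℕ),
    StrictMono x ∧ (∀ j, x j ∈ Icc (-1 : ℝ) 1) ∧ (∀ j, 0 < k j) ∧ ∑ j, k j = N ∧
      J = jPlusNodes α D x k}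

/-- `δ_D = sup {δ_D(x) : x ∈ [-1, 1]}`, where `δ_D(x)` is the distance from `x` to `ℂ \ D`. -/
def deltaDom (D : Set ℂ) : ℝ :=
  sSup ((fun t : ℝ => Metric.infDist (t : ℂ) Dᶜ) '' Icc (-1 : ℝ) 1)

end

section

open Filter Metric Topology
open scoped ENNReal

/-! The bound comes from one explicit competitor. For each node `x j` let `B j` be the Riemann map
of `D` onto the disc sending `x j` to `0`; by symmetry it can be taken real on the real points of
`D`. The product of the `B j ^ (2 * k j)` lies in the family: the even exponents make it nonnegative
on the reals, at the cost of doubling the order of the zeros.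

Size of the factors: a Koebe bound with constant `c` (4 in general, 2 for convex `D`) compares the
hyperbolic density with the distance to the boundary, so `1 - B² ≤ C * B'` on `[-1,1]` with `C = c *
δ_D`. Integrating gives `|B t| ≥ |t - x| / (C + |t - x|)`.

Size of the integral: by Jensen's inequality for `exp`, it suffices to bound below the integral of
`log (|t - x| / (C + |t - x|))`. The worst node is `x = 0`, where the value is `2 * (C log C - (C +
1) log (C + 1))`. With `L = 1 / c` this is the stated bound.

The carriers are `exists_riemannMap`, `koebeBound_four`, `koebeBound_two_of_convex`,
`IsNiceDomain.exists_map_lower_bound`, `integral_log_sub_log_ge` and `two_mul_exp_le_integral`. -/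

/-! ### Normal families: Montel and Hurwitz. -/

/-- A sequence of holomorphic maps into the unit disc converges locally uniformly along every
ultrafilter (Montel). -/
theorem exists_tendstoLocallyUniformlyOn_ultrafilter {U : Set ℂ} (hU : IsOpen U)
    {F : ℕ → ℂ → ℂ} (hF : ∀ n, DifferentiableOn ℂ (F n) U)
    (hb : ∀ n, MapsTo (F n) U (ball 0 1)) (φ : Ultrafilter ℕ) :
    ∃ f : ℂ → ℂ, TendstoLocallyUniformlyOn F f φ U ∧ MapsTo f U (closedBall 0 1) := by
  -- Along an ultrafilter, values in the compact closed disc converge, so no subsequence is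
  -- extracted. Off `U` the limit function is set to `0`.
  have hpt : ∀ z : ℂ, ∃ a : ℂ, z ∈ U →
      a ∈ closedBall (0 : ℂ) 1 ∧ Tendsto (fun n => F n z) φ (𝓝 a) := by
    intro z
    by_cases hz : z ∈ U
    · obtain ⟨a, ha, hle⟩ := (isCompact_closedBall (0 : ℂ) 1).ultrafilter_le_nhds
        (φ.map (fun n => F n z)) (by
          rw [Ultrafilter.coe_map, le_principal_iff, mem_map]
          exact univ_mem' fun n => ball_subset_closedBall (hb n hz))
      exact ⟨a, fun _ => ⟨ha, hle⟩⟩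
    · exact ⟨0, fun h => absurd h hz⟩
  choose f hf using hpt
  refine ⟨f, ?_, fun z hz => (hf z hz).1⟩
  rw [tendstoLocallyUniformlyOn_iff_forall_isCompact hU]
  intro K hKU hK
  -- The Schwarz lemma on a ball of radius `r` gives the Lipschitz constant `2 / r`, uniformly in
  -- `n`; equicontinuity upgrades pointwise to uniform convergence on `K`.
  have heq : EquicontinuousOn F K := by
    intro z hz
    refine EquicontinuousAt.equicontinuousWithinAt ?_ _
    obtain ⟨r, hr, hrU⟩ := Metric.isOpen_iff.mp hU z (hKU hz)
    refine Metric.equicontinuousAt_of_continuity_modulus (fun w => 2 / r * dist w z) ?_ F ?_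
    · have : Continuous fun w : ℂ => 2 / r * dist w z := by fun_prop
      simpa using this.tendsto z
    · filter_upwards [ball_mem_nhds z hr] with w hw n
      rw [dist_comm]
      refine Complex.dist_le_div_mul_dist_of_mapsTo_ball ((hF n).mono hrU) ?_ hw
      intro v hv
      have h1 := mem_ball_zero_iff.mp (hb n (hrU hv))
      have h2 := mem_ball_zero_iff.mp (hb n (hKU hz))
      rw [mem_closedBall, dist_eq_norm]
      linarith [norm_sub_le (F n v) (F n z)]
  have key := (EquicontinuousOn.tendsto_uniformOnFun_iff_pi' (𝔖 := {K})
    (by rintro _ rfl; exact hK) (by rintro _ rfl; exact heq) (φ : Filter ℕ) f).mpr (by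
      rw [tendsto_pi_nhds]
      rintro ⟨z, hz⟩
      have hz' : z ∈ K := by simpa using hz
      exact (hf z (hKU hz')).2)
  exact (UniformOnFun.tendsto_iff_tendstoUniformlyOn.mp key) K rfl

/-- Hurwitz: near a zero of a locally uniform limit of holomorphic functions, unless the limit
vanishes identically near that zero, the approximating functions eventually have zeros. -/
theorem TendstoLocallyUniformlyOn.eventually_exists_zero {U : Set ℂ} (hU : IsOpen U)
    {F : ℕ → ℂ → ℂ} {f : ℂ → ℂ} {φ : Filter ℕ} [φ.NeBot]
    (hF : ∀ n, DifferentiableOn ℂ (F n) U)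
    (h : TendstoLocallyUniformlyOn F f φ U) {a : ℂ} (ha : a ∈ U) (hfa : f a = 0)
    (hne : ¬ ∀ᶠ z in 𝓝 a, f z = 0) {ρ : ℝ} (hρ : 0 < ρ) :
    ∀ᶠ n in φ, ∃ z ∈ U ∩ ball a ρ, F n z = 0 := by
  have hfd : DifferentiableOn ℂ f U := h.differentiableOn (Eventually.of_forall hF) hU
  have han : AnalyticAt ℂ f a := hfd.analyticAt (hU.mem_nhds ha)
  have hiso : ∀ᶠ z in 𝓝[≠] a, f z ≠ 0 :=
    han.eventually_eq_zero_or_eventually_ne_zero.resolve_left hne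
  rw [eventually_nhdsWithin_iff] at hiso
  obtain ⟨s, hs, hsub⟩ := Metric.eventually_nhds_iff_ball.mp hiso
  obtain ⟨r, hr, hrU⟩ := Metric.isOpen_iff.mp hU a ha
  set t := min (min s r) ρ / 2 with ht
  have ht0 : 0 < t := by positivity
  have hts : t < s := by
    have := min_le_left (min s r) ρ; have := min_le_left s r; linarith [lt_min (lt_min hs hr) hρ]
  have htr : t < r := by
    have := min_le_left (min s r) ρ; have := min_le_right s r; linarith [lt_min (lt_min hs hr) hρ]
  have htρ : t < ρ := by
    have := min_le_right (min s r) ρ; linarith [lt_min (lt_min hs hr) hρ]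
  have hcb : closedBall a t ⊆ U := (closedBall_subset_ball htr).trans hrU
  have hsph : ∀ z ∈ sphere a t, f z ≠ 0 := fun z hz =>
    hsub z (by rw [mem_ball, mem_sphere.mp hz]; exact hts)
      (by rintro rfl; simp at hz; exact ht0.ne hz)
  obtain ⟨z₀, hz₀, hmin⟩ := (isCompact_sphere a t).exists_isMinOn
    (NormedSpace.sphere_nonempty.mpr ht0.le)
    ((hfd.continuousOn.mono (sphere_subset_closedBall.trans hcb)).norm)
  set ε := ‖f z₀‖ with hε
  have hε0 : 0 < ε := norm_pos_iff.mpr (hsph z₀ hz₀)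
  have hunif : TendstoUniformlyOn F f φ (closedBall a t) :=
    (tendstoLocallyUniformlyOn_iff_forall_isCompact hU).mp h _ hcb (isCompact_closedBall a t)
  filter_upwards [Metric.tendstoUniformlyOn_iff.mp hunif (ε / 8) (by positivity)] with n hn
  have hFa : ‖F n a‖ < ε / 8 := by
    have := hn a (mem_closedBall_self ht0.le)
    rwa [hfa, dist_zero_left] at this
  have hFs : ∀ z ∈ sphere a t, ε / 2 ≤ ‖F n z - F n a‖ := by
    intro z hz
    have h1 := hn z (sphere_subset_closedBall hz)
    have h2 : ε ≤ ‖f z‖ := hmin hz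
    rw [dist_eq_norm] at h1
    have h3 := norm_sub_norm_le (f z) (F n z)
    have h4 := norm_sub_norm_le (F n z) (F n a)
    linarith
  have hdc : DiffContOnCl ℂ (F n) (ball a t) :=
    ((hF n).mono (by rw [closure_ball a ht0.ne']; exact hcb)).diffContOnCl
  have hfreq : ∃ᶠ z in 𝓝 a, F n z ≠ F n a := by
    intro hcon
    simp only [not_not] at hcon
    have hpre : IsPreconnected (ball a r) := (convex_ball a r).isPreconnected
    have hEq := AnalyticOnNhd.eqOn_of_preconnected_of_eventuallyEq
      (((hF n).mono hrU).analyticOnNhd isOpen_ball)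
      (analyticOnNhd_const (v := F n a)) hpre (mem_ball_self hr) hcon
    have h1 := hFs z₀ hz₀
    rw [hEq (by rw [mem_ball, mem_sphere.mp hz₀]; exact htr)] at h1
    simp at h1
    linarith
  -- Quantitative open mapping: the image covers the ball of radius `ε / 4` about `F n a`, which
  -- contains `0` because `‖F n a‖ < ε / 8`.
  obtain ⟨z, hz, hz0⟩ := hdc.ball_subset_image_closedBall ht0 hFs hfreq
    (show (0 : ℂ) ∈ ball (F n a) (ε / 2 / 2) by
      rw [mem_ball, dist_zero_left]; linarith)
  exact ⟨z, ⟨hcb hz, (mem_closedBall.mp hz).trans_lt htρ⟩, hz0⟩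

/-! ### Automorphisms of the unit disc. -/

/-- The Möbius map `z ↦ (z - a) / (1 - ā z)`, an automorphism of the unit disc when `‖a‖ < 1`. -/
noncomputable def discAut (a z : ℂ) : ℂ := (z - a) / (1 - starRingEnd ℂ a * z)

theorem one_sub_conj_mul_ne_zero {a z : ℂ} (ha : ‖a‖ < 1) (hz : ‖z‖ < 1) :
    1 - starRingEnd ℂ a * z ≠ 0 := by
  intro h
  have h1 : ‖starRingEnd ℂ a * z‖ = 1 := by rw [← sub_eq_zero.mp h]; simp
  rw [norm_mul, RCLike.norm_conj] at h1
  nlinarith [norm_nonneg a, norm_nonneg z]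

theorem discAut_mapsTo {a : ℂ} (ha : ‖a‖ < 1) : MapsTo (discAut a) (ball 0 1) (ball 0 1) := by
  intro z hz
  rw [mem_ball_zero_iff] at hz ⊢
  have h0 := one_sub_conj_mul_ne_zero ha hz
  rw [discAut, norm_div, div_lt_one (norm_pos_iff.mpr h0)]
  refine lt_of_pow_lt_pow_left₀ 2 (norm_nonneg _) ?_
  have h1 : ‖1 - starRingEnd ℂ a * z‖ ^ 2 - ‖z - a‖ ^ 2 = (1 - ‖a‖ ^ 2) * (1 - ‖z‖ ^ 2) := by
    simp only [← Complex.normSq_eq_norm_sq, Complex.normSq_apply]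
    simp
    ring
  have h2 : 0 < (1 - ‖a‖ ^ 2) * (1 - ‖z‖ ^ 2) := by
    apply mul_pos <;> nlinarith [norm_nonneg a, norm_nonneg z]
  linarith

theorem discAut_neg_discAut {a z : ℂ} (ha : ‖a‖ < 1) (hz : ‖z‖ < 1) :
    discAut (-a) (discAut a z) = z := by
  have h0 := one_sub_conj_mul_ne_zero ha hz
  have h1 := one_sub_conj_mul_ne_zero ha ha
  unfold discAut
  rw [map_neg, sub_neg_eq_add, neg_mul, sub_neg_eq_add]
  generalize starRingEnd ℂ a = c at h0 h1 ⊢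
  have e1 : (z - a) / (1 - c * z) + a = z * (1 - c * a) / (1 - c * z) := by
    rw [div_add' _ _ _ h0]; ring
  have e2 : 1 + c * ((z - a) / (1 - c * z)) = (1 - c * a) / (1 - c * z) := by
    rw [← mul_div_assoc, ← sub_neg_eq_add, ← neg_div, eq_comm, div_eq_iff h0, sub_mul,
      div_mul_cancel₀ _ h0]
    ring
  rw [e1, e2, div_div_div_cancel_right₀ h0, mul_div_cancel_right₀ _ h1]

theorem hasDerivAt_discAut {a z : ℂ} (ha : ‖a‖ < 1) (hz : ‖z‖ < 1) :
    HasDerivAt (discAut a)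
      ((1 - starRingEnd ℂ a * a) / (1 - starRingEnd ℂ a * z) ^ 2) z := by
  have h0 := one_sub_conj_mul_ne_zero ha hz
  have := ((hasDerivAt_id z).sub_const a).div
    (((hasDerivAt_id z).const_mul (starRingEnd ℂ a)).const_sub 1) h0
  convert! this using 1
  simp only [id]
  ring

theorem injOn_discAut {a : ℂ} (ha : ‖a‖ < 1) : InjOn (discAut a) (ball 0 1) := by
  intro z hz w hw h
  rw [← discAut_neg_discAut ha (mem_ball_zero_iff.mp hz), h,
    discAut_neg_discAut ha (mem_ball_zero_iff.mp hw)]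

theorem discAut_self (a : ℂ) : discAut a a = 0 := by simp [discAut]

theorem discAut_zero (a : ℂ) : discAut a 0 = -a := by simp [discAut]

/-! ### The Riemann mapping theorem. -/

/-- A continuous square root of a holomorphic nonvanishing function is holomorphic. -/
theorem hasDerivAt_of_sq_eq {U : Set ℂ} (hU : IsOpen U) {s g : ℂ → ℂ} (hs : ContinuousOn s U)
    (hsq : ∀ z ∈ U, s z ^ 2 = g z) {z g' : ℂ} (hz : z ∈ U) (hg : HasDerivAt g g' z)
    (h0 : g z ≠ 0) : HasDerivAt s (g' / (2 * s z)) z := by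
  have hs0 : s z ≠ 0 := fun h => h0 (by rw [← hsq z hz, h]; simp)
  have hcs : Tendsto s (𝓝 z) (𝓝 (s z)) := hs.continuousAt (hU.mem_nhds hz)
  rw [hasDerivAt_iff_tendsto_slope] at hg ⊢
  have hadd : Tendsto (fun w => s w + s z) (𝓝[≠] z) (𝓝 (2 * s z)) := by
    have := (hcs.add_const (s z)).mono_left (nhdsWithin_le_nhds (s := {z}ᶜ))
    rwa [← two_mul] at this
  have h2 : (2 * s z) ≠ 0 := mul_ne_zero two_ne_zero hs0
  refine (hg.div hadd h2).congr' ?_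
  filter_upwards [hadd.eventually_ne h2, nhdsWithin_le_nhds (hU.mem_nhds hz)] with w hw hwU
  rw [Pi.div_apply, slope_def_field, slope_def_field, ← hsq w hwU, ← hsq z hz, div_eq_iff hw]
  ring

/-- An injective holomorphic map of `U` into the unit disc with nonvanishing derivative. -/
structure IsUnivalentToDisc (U : Set ℂ) (F : ℂ → ℂ) : Prop where
  differentiableOn : DifferentiableOn ℂ F U
  mapsTo : MapsTo F U (ball 0 1)
  injOn : InjOn F U
  deriv_ne_zero : ∀ z ∈ U, deriv F z ≠ 0

theorem norm_discAut_deriv_self {a : ℂ} (ha : ‖a‖ < 1) :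
    ‖deriv (discAut a) a‖ = 1 / (1 - ‖a‖ ^ 2) := by
  have h0 := one_sub_conj_mul_ne_zero ha ha
  rw [(hasDerivAt_discAut ha ha).deriv, pow_two, ← div_div, div_self h0, norm_div, norm_one,
    mul_comm, Complex.mul_conj, Complex.normSq_eq_norm_sq]
  norm_cast
  rw [Real.norm_of_nonneg]
  nlinarith [norm_nonneg a]

theorem deriv_discAut_ne_zero {a z : ℂ} (ha : ‖a‖ < 1) (hz : ‖z‖ < 1) :
    deriv (discAut a) z ≠ 0 := by
  rw [(hasDerivAt_discAut ha hz).deriv]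
  exact div_ne_zero (one_sub_conj_mul_ne_zero ha ha)
    (pow_ne_zero 2 (one_sub_conj_mul_ne_zero ha hz))

theorem IsUnivalentToDisc.deriv_discAut_comp {U : Set ℂ} {F : ℂ → ℂ} (hU : IsOpen U)
    (hF : IsUnivalentToDisc U F) {a z : ℂ} (ha : ‖a‖ < 1) (hz : z ∈ U) :
    deriv (fun z => discAut a (F z)) z = deriv (discAut a) (F z) * deriv F z := by
  have hFz := mem_ball_zero_iff.mp (hF.mapsTo hz)
  rw [(hasDerivAt_discAut ha hFz).deriv]
  exact ((hasDerivAt_discAut ha hFz).comp z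
    (hF.differentiableOn.differentiableAt (hU.mem_nhds hz)).hasDerivAt).deriv

theorem IsUnivalentToDisc.discAut_comp {U : Set ℂ} {F : ℂ → ℂ} (hU : IsOpen U)
    (hF : IsUnivalentToDisc U F) {a : ℂ} (ha : ‖a‖ < 1) :
    IsUnivalentToDisc U (fun z => discAut a (F z)) where
  differentiableOn z hz :=
    ((hasDerivAt_discAut ha (mem_ball_zero_iff.mp (hF.mapsTo hz))).differentiableAt.comp z
      (hF.differentiableOn.differentiableAt (hU.mem_nhds hz))).differentiableWithinAt
  mapsTo := (discAut_mapsTo ha).comp hF.mapsTo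
  injOn := (injOn_discAut ha).comp hF.injOn hF.mapsTo
  deriv_ne_zero z hz := by
    rw [hF.deriv_discAut_comp hU ha hz]
    exact mul_ne_zero (deriv_discAut_ne_zero ha (mem_ball_zero_iff.mp (hF.mapsTo hz)))
      (hF.deriv_ne_zero z hz)

/-- A square root `s` of `z - p` never takes both a value and its negative. Its image contains a
ball about `s x`, hence avoids the ball about `-s x`, and an inversion centred at `-s x` lands in
the disc. -/
theorem exists_isUnivalentToDisc {U : Set ℂ} (hUo : IsOpen U)
    (hUc : IsSimplyConnected U) (hU : U ≠ univ) : ∃ f, IsUnivalentToDisc U f := by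
  obtain ⟨p, hp⟩ := (ne_univ_iff_exists_notMem U).mp hU
  obtain ⟨x, hx⟩ := hUc.nonempty
  have hne : ∀ z ∈ U, z - p ≠ 0 := fun z hz h => hp (by rwa [← sub_eq_zero.mp h])
  obtain ⟨s, hsc, hsq⟩ := Complex.exists_continuousOn_pow_eq hUc hUo
    (g := fun z => z - p) (by fun_prop) (by rintro ⟨z, hz, h⟩; exact hne z hz h) two_ne_zero
  have hs0 : ∀ z ∈ U, s z ≠ 0 := fun z hz h => hne z hz (by rw [← hsq z, h]; simp)
  have hsd : ∀ z ∈ U, HasDerivAt s (1 / (2 * s z)) z := fun z hz =>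
    hasDerivAt_of_sq_eq hUo hsc (fun z _ => hsq z) hz ((hasDerivAt_id z).sub_const p) (hne z hz)
  have hsdiff : DifferentiableOn ℂ s U := fun z hz =>
    (hsd z hz).differentiableAt.differentiableWithinAt
  have hsinj : ∀ a b, s a ^ 2 = s b ^ 2 → a = b := fun a b h => by
    rw [hsq, hsq] at h; exact sub_left_injective h
  have himg : s '' U ∈ 𝓝 (s x) := by
    have hst : HasStrictDerivAt s (deriv s x) x :=
      (hsdiff.analyticAt (hUo.mem_nhds hx)).hasStrictDerivAt
    rw [← hst.map_nhds_eq (by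
      rw [(hsd x hx).deriv]; exact div_ne_zero one_ne_zero (mul_ne_zero two_ne_zero (hs0 x hx)))]
    exact image_mem_map (hUo.mem_nhds hx)
  obtain ⟨ε, hε, hball⟩ := Metric.mem_nhds_iff.mp himg
  have hfar : ∀ z ∈ U, ε ≤ ‖s z + s x‖ := by
    intro z hz
    by_contra! hlt
    obtain ⟨w, hw, hwz⟩ := hball (show -s z ∈ ball (s x) ε by
      rwa [mem_ball, dist_eq_norm, ← norm_neg, neg_sub, sub_neg_eq_add, add_comm])
    have : w = z := hsinj w z (by rw [hwz, neg_sq])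
    subst this
    exact hs0 w hw (self_eq_neg.mp hwz)
  have hfar0 : ∀ z ∈ U, s z + s x ≠ 0 := fun z hz h => by
    have := hfar z hz; rw [h, norm_zero] at this; linarith
  have hfd : ∀ z ∈ U, HasDerivAt (fun z => ((ε / 2 : ℝ) : ℂ) / (s z + s x))
      (-(((ε / 2 : ℝ) : ℂ) * (1 / (2 * s z))) / (s z + s x) ^ 2) z := by
    intro z hz
    convert! (hasDerivAt_const z (((ε / 2 : ℝ) : ℂ))).div ((hsd z hz).add_const (s x))
      (hfar0 z hz) using 1
    ring
  have hε2 : ((ε / 2 : ℝ) : ℂ) ≠ 0 := by exact_mod_cast (half_pos hε).ne'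
  refine ⟨fun z => ((ε / 2 : ℝ) : ℂ) / (s z + s x),
    fun z hz => (hfd z hz).differentiableAt.differentiableWithinAt, ?_, ?_, ?_⟩
  · intro z hz
    rw [mem_ball_zero_iff, norm_div, Complex.norm_real, Real.norm_of_nonneg (by positivity),
      div_lt_one (norm_pos_iff.mpr (hfar0 z hz))]
    linarith [hfar z hz]
  · intro a ha b hb hab
    simp only [div_eq_mul_inv] at hab
    have := add_right_cancel (inv_injective (mul_left_cancel₀ hε2 hab))
    exact hsinj a b (by rw [this])
  · intro z hz
    rw [(hfd z hz).deriv]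
    exact div_ne_zero (neg_ne_zero.mpr (mul_ne_zero hε2 (div_ne_zero one_ne_zero
      (mul_ne_zero two_ne_zero (hs0 z hz))))) (pow_ne_zero 2 (hfar0 z hz))

/-- Among the univalent maps of `U` into the disc vanishing at `x` there is one of maximal
derivative at `x`. -/
theorem exists_isUnivalentToDisc_maximal {U : Set ℂ} (hUo : IsOpen U)
    (hUc : IsSimplyConnected U) (hU : U ≠ univ) {x : ℂ} (hx : x ∈ U) :
    ∃ f, IsUnivalentToDisc U f ∧ f x = 0 ∧
      ∀ g, IsUnivalentToDisc U g → g x = 0 → ‖deriv g x‖ ≤ ‖deriv f x‖ := by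
  have hpre : IsPreconnected U := hUc.isPathConnected.isConnected.isPreconnected
  set S : Set ℝ := {m | ∃ g, IsUnivalentToDisc U g ∧ g x = 0 ∧ m = ‖deriv g x‖} with hS
  obtain ⟨f₀, hf₀⟩ := exists_isUnivalentToDisc hUo hUc hU
  have h₁ := hf₀.discAut_comp hUo (mem_ball_zero_iff.mp (hf₀.mapsTo hx))
  have hmem : ‖deriv (fun z => discAut (f₀ x) (f₀ z)) x‖ ∈ S := ⟨_, h₁, discAut_self _, rfl⟩
  -- By Schwarz, a ball of radius `r` inside `U` bounds all competing derivatives by `1 / r`.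
  have hbdd : BddAbove S := by
    obtain ⟨r, hr, hrU⟩ := Metric.isOpen_iff.mp hUo x hx
    refine ⟨1 / r, ?_⟩
    rintro _ ⟨g, hg, hgx, rfl⟩
    refine Complex.norm_deriv_le_div_of_mapsTo_ball (hg.differentiableOn.mono hrU) ?_ hr
    rw [hgx]
    exact fun z hz => ball_subset_closedBall (hg.mapsTo (hrU hz))
  have hMpos : 0 < sSup S :=
    (norm_pos_iff.mpr (h₁.deriv_ne_zero x hx)).trans_le (le_csSup hbdd hmem)
  obtain ⟨u, -, hu, huS⟩ := exists_seq_tendsto_sSup ⟨_, hmem⟩ hbdd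
  choose F hF hFx huF using huS
  set φ := hyperfilter ℕ
  obtain ⟨f, hf, hfcb⟩ := exists_tendstoLocallyUniformlyOn_ultrafilter hUo
    (fun n => (hF n).differentiableOn) (fun n => (hF n).mapsTo) φ
  have hfd : DifferentiableOn ℂ f U :=
    hf.differentiableOn (Eventually.of_forall fun n => (hF n).differentiableOn) hUo
  have hderiv : TendstoLocallyUniformlyOn (deriv ∘ F) (deriv f) φ U :=
    hf.deriv (Eventually.of_forall fun n => (hF n).differentiableOn) hUo
  have hfx : f x = 0 := by
    have := hf.tendsto_at hx
    simp only [hFx] at this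
    exact tendsto_nhds_unique tendsto_const_nhds this |>.symm
  have hφ : (φ : Filter ℕ) ≤ atTop := by
    rw [← Nat.cofinite_eq_atTop]; exact hyperfilter_le_cofinite
  have hfM : ‖deriv f x‖ = sSup S := by
    have h1 := (hderiv.tendsto_at hx).norm
    have h2 := hu.mono_left hφ
    refine tendsto_nhds_unique h1 (h2.congr fun n => huF n)
  have hfx' : deriv f x ≠ 0 := norm_pos_iff.mp (hfM ▸ hMpos)
  have hana : AnalyticOnNhd ℂ f U := hfd.analyticOnNhd hUo
  have hconst : ∀ c, ¬ EqOn f (fun _ => c) U := by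
    intro c hc
    apply hfx'
    rw [(hc.eventuallyEq_of_mem (hUo.mem_nhds hx)).deriv_eq, deriv_const]
  have hloc : ∀ a ∈ U, ∀ c, ¬ ∀ᶠ z in 𝓝 a, f z = c := fun a ha c hc =>
    hconst c (hana.eqOn_of_preconnected_of_eventuallyEq analyticOnNhd_const hpre ha hc)
  refine ⟨f, ⟨hfd, ?_, ?_, ?_⟩, hfx, fun g hg hgx => hfM ▸ le_csSup hbdd ⟨g, hg, hgx, rfl⟩⟩
  · intro z hz
    have hle := mem_closedBall_zero_iff.mp (hfcb hz)
    refine mem_ball_zero_iff.mpr (hle.lt_of_ne fun h1 => ?_)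
    refine hconst (f z) (Complex.eqOn_of_isPreconnected_of_isMaxOn_norm hpre hUo hfd hz ?_)
    exact fun w hw => by
      simpa [h1] using mem_closedBall_zero_iff.mp (hfcb hw)
  · intro a ha b hb hab
    by_contra hne
    -- If `f a = f b`, Hurwitz gives zeros of `F n - F n b` closer to `a` than `b` is, against
    -- injectivity of `F n`.
    have hlim : TendstoLocallyUniformlyOn (fun n z => F n z - F n b) (fun z => f z - f b) φ U := by
      rw [tendstoLocallyUniformlyOn_iff_forall_isCompact hUo] at hf ⊢
      intro K hKU hK
      refine (hf K hKU hK).sub ?_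
      have := hf {b} (by simpa using hb) isCompact_singleton
      rw [Metric.tendstoUniformlyOn_iff] at this ⊢
      intro ε hε
      filter_upwards [this ε hε] with n hn z _
      exact hn b rfl
    obtain ⟨n, z, ⟨hzU, hzb⟩, hz0⟩ := (hlim.eventually_exists_zero hUo
      (fun n => (hF n).differentiableOn.sub_const _) ha (sub_eq_zero.mpr hab)
      (fun h => hloc a ha (f b) (h.mono fun z hz => sub_eq_zero.mp hz))
      (dist_pos.mpr hne)).exists
    have := (hF n).injOn hzU hb (sub_eq_zero.mp hz0)
    rw [this, mem_ball, dist_comm] at hzb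
    exact lt_irrefl _ hzb
  · intro a ha h0
    have hdd : DifferentiableOn ℂ (deriv f) U := hfd.deriv hUo
    obtain ⟨n, z, ⟨hzU, -⟩, hz0⟩ := (hderiv.eventually_exists_zero hUo
      (fun n => (hF n).differentiableOn.deriv hUo) ha h0 (fun h => hfx'
        ((hdd.analyticOnNhd hUo).eqOn_of_preconnected_of_eventuallyEq
          (analyticOnNhd_const (v := (0 : ℂ))) hpre ha h hx)) one_pos).exists
    exact (hF n).deriv_ne_zero z hzU hz0

/-- **Riemann mapping theorem.** -/
theorem exists_riemannMap {U : Set ℂ} (hUo : IsOpen U) (hUc : IsSimplyConnected U)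
    (hU : U ≠ univ) {x : ℂ} (hx : x ∈ U) :
    ∃ f, IsUnivalentToDisc U f ∧ f x = 0 ∧ SurjOn f U (ball 0 1) := by
  obtain ⟨f, hf, hfx, hmax⟩ := exists_isUnivalentToDisc_maximal hUo hUc hU hx
  refine ⟨f, hf, hfx, ?_⟩
  intro w hw
  by_contra hnot
  have hw1 : ‖w‖ < 1 := mem_ball_zero_iff.mp hw
  have hw0 : w ≠ 0 := by rintro rfl; exact hnot ⟨x, hx, hfx⟩
  -- Koebe's square-root trick: move the omitted value `w` to `0`, take a square root `s`,
  -- renormalise at `x`. With `σ = ‖s x‖ < 1` the derivative at `x` grows by the factor `(1 + σ²) /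
  -- (2σ) > 1`, contradicting maximality.
  have hg := hf.discAut_comp hUo hw1
  set g : ℂ → ℂ := fun z => discAut w (f z) with hgdef
  have hg0 : ∀ z ∈ U, g z ≠ 0 := by
    intro z hz h
    have : f z = w := injOn_discAut hw1 (hf.mapsTo hz) hw (by rw [discAut_self]; exact h)
    exact hnot ⟨z, hz, this⟩
  obtain ⟨s, hsc, hsq⟩ := Complex.exists_continuousOn_pow_eq hUc hUo hg.differentiableOn.continuousOn
    (by rintro ⟨z, hz, h⟩; exact hg0 z hz h) two_ne_zero
  have hs0 : ∀ z ∈ U, s z ≠ 0 := fun z hz h => hg0 z hz (by rw [← hsq z, h]; simp)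
  have hsd : ∀ z ∈ U, HasDerivAt s (deriv g z / (2 * s z)) z := fun z hz =>
    hasDerivAt_of_sq_eq hUo hsc (fun z _ => hsq z) hz
      (hg.differentiableOn.differentiableAt (hUo.mem_nhds hz)).hasDerivAt (hg0 z hz)
  have hs : IsUnivalentToDisc U s := by
    refine ⟨fun z hz => (hsd z hz).differentiableAt.differentiableWithinAt, ?_, ?_, ?_⟩
    · intro z hz
      have := mem_ball_zero_iff.mp (hg.mapsTo hz)
      rw [← hsq z, norm_pow] at this
      rw [mem_ball_zero_iff]
      exact (pow_lt_one_iff_of_nonneg (norm_nonneg _) two_ne_zero).mp this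
    · intro a ha b hb hab
      exact hg.injOn ha hb (by rw [← hsq a, ← hsq b, hab])
    · intro z hz
      rw [(hsd z hz).deriv]
      exact div_ne_zero (hg.deriv_ne_zero z hz) (mul_ne_zero two_ne_zero (hs0 z hz))
  have hsx1 : ‖s x‖ < 1 := mem_ball_zero_iff.mp (hs.mapsTo hx)
  have hle := hmax _ (hs.discAut_comp hUo hsx1) (discAut_self _)
  rw [hs.deriv_discAut_comp hUo hsx1 hx, norm_mul, norm_discAut_deriv_self hsx1, (hsd x hx).deriv,
    norm_div, norm_mul, hf.deriv_discAut_comp hUo hw1 hx, norm_mul, hfx,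
    (hasDerivAt_discAut hw1 (by simp : ‖(0 : ℂ)‖ < 1)).deriv, mul_comm (starRingEnd ℂ w) w,
    Complex.mul_conj, Complex.normSq_eq_norm_sq] at hle
  have hsw : ‖w‖ = ‖s x‖ ^ 2 := by
    rw [← norm_pow, hsq x, hgdef]
    simp [hfx, discAut_zero]
  have hM : 0 < ‖deriv f x‖ := norm_pos_iff.mpr (hf.deriv_ne_zero x hx)
  have hσ : 0 < ‖s x‖ := norm_pos_iff.mpr (hs0 x hx)
  have e1 : ‖(1 - ((‖w‖ ^ 2 : ℝ) : ℂ)) / (1 - starRingEnd ℂ w * 0) ^ 2‖ = 1 - ‖s x‖ ^ 4 := by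
    rw [mul_zero, sub_zero, one_pow, div_one]
    norm_cast
    rw [hsw, Real.norm_of_nonneg]
    · ring
    · have : ‖s x‖ ^ 2 < 1 := by nlinarith
      nlinarith [sq_nonneg ‖s x‖]
  rw [e1] at hle
  set σ := ‖s x‖
  have hσ2 : 0 < 1 - σ ^ 2 := by nlinarith
  have e2 : 1 / (1 - σ ^ 2) * ((1 - σ ^ 4) * ‖deriv f x‖ / (‖(2 : ℂ)‖ * σ))
      = (1 + σ ^ 2) / (2 * σ) * ‖deriv f x‖ := by
    rw [show ‖(2 : ℂ)‖ = 2 by simp]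
    field_simp
    ring
  rw [e2] at hle
  have h1 : (1 + σ ^ 2) / (2 * σ) ≤ 1 := le_of_mul_le_mul_right (by rwa [one_mul]) hM
  rw [div_le_one (by positivity)] at h1
  nlinarith [sq_pos_of_pos (sub_pos.mpr hsx1)]

/-! ### Logarithmic area and the Bieberbach–Eilenberg inequality. -/

theorem lintegral_image_of_hasDerivAt {s : Set ℂ} (hs : MeasurableSet s) {f f' : ℂ → ℂ}
    (hf : ∀ z ∈ s, HasDerivAt f (f' z) z) (hinj : InjOn f s) (g : ℂ → ℝ≥0∞) :
    ∫⁻ w in f '' s, g w = ∫⁻ z in s, ‖f' z ^ 2‖ₑ * g (f z) := by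
  rw [lintegral_image_eq_lintegral_abs_det_fderiv_mul volume hs
    (fun z hz => (hf z hz).complexToReal_fderiv.hasFDerivWithinAt) hinj]
  refine setLIntegral_congr_fun hs fun z _ => ?_
  have hdet : (f' z • (1 : ℂ →L[ℝ] ℂ)).det = ‖f' z‖ ^ 2 := by
    rw [← Complex.normSq_eq_norm_sq, ← Algebra.norm_complex_apply, Algebra.norm_apply,
      ContinuousLinearMap.det]
    congr 1
  simp only [hdet]
  rw [abs_of_nonneg (by positivity), ← norm_pow, ofReal_norm]

theorem lintegral_annulus_eq {f : ℂ → ℝ≥0∞} {r R : ℝ} (hr : 0 ≤ r)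
    (hf : ContinuousOn f {z | r < ‖z‖ ∧ ‖z‖ < R}) :
    ∫⁻ z in {z : ℂ | r < ‖z‖ ∧ ‖z‖ < R}, f z =
      ∫⁻ ρ in Ioo r R, ∫⁻ θ in Ioo (-Real.pi) Real.pi,
        ENNReal.ofReal ρ * f (circleMap 0 ρ θ) := by
  have hA : MeasurableSet {z : ℂ | r < ‖z‖ ∧ ‖z‖ < R} :=
    (measurableSet_lt measurable_const measurable_norm).inter
      (measurableSet_lt measurable_norm measurable_const)
  have hsymm : ∀ p : ℝ × ℝ, Complex.polarCoord.symm p = circleMap 0 p.1 p.2 := by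
    intro p
    rw [Complex.polarCoord_symm_apply, circleMap, zero_add, Complex.exp_mul_I]
    push_cast; ring
  rw [← lintegral_indicator hA, ← Complex.lintegral_comp_polarCoord_symm,
    show polarCoord.target = Ioi (0 : ℝ) ×ˢ Ioo (-Real.pi) Real.pi from rfl,
    ← setLIntegral_prod (fun p : ℝ × ℝ => ENNReal.ofReal p.1 * f (circleMap 0 p.1 p.2))]
  · have hS : MeasurableSet (Ioo r R ×ˢ Ioo (-Real.pi) Real.pi) :=
      measurableSet_Ioo.prod measurableSet_Ioo
    have hT : MeasurableSet (Ioi (0 : ℝ) ×ˢ Ioo (-Real.pi) Real.pi) :=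
      measurableSet_Ioi.prod measurableSet_Ioo
    rw [← lintegral_indicator hS, ← lintegral_indicator hT]
    refine lintegral_congr fun p => ?_
    by_cases hp : p ∈ Ioi (0 : ℝ) ×ˢ Ioo (-Real.pi) Real.pi
    · have hp0 : 0 < p.1 := hp.1
      rw [indicator_of_mem hp, hsymm]
      by_cases hpS : p ∈ Ioo r R ×ˢ Ioo (-Real.pi) Real.pi
      · rw [indicator_of_mem hpS, indicator_of_mem (by
          simpa [abs_of_pos hp0] using hpS.1), smul_eq_mul]
      · rw [indicator_of_notMem hpS, indicator_of_notMem, smul_zero]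
        intro h
        exact hpS ⟨by simpa [abs_of_pos hp0] using h, hp.2⟩
    · rw [indicator_of_notMem hp, indicator_of_notMem]
      exact fun h => hp ⟨hr.trans_lt h.1.1, h.2⟩
  · refine ContinuousOn.aemeasurable ?_ (measurableSet_Ioo.prod measurableSet_Ioo)
    refine ContinuousOn.mono (s := Ioo r R ×ˢ univ) ?_ (prod_mono_right (subset_univ _))
    have h1 : ContinuousOn (fun p : ℝ × ℝ => f (circleMap 0 p.1 p.2)) (Ioo r R ×ˢ univ) := by
      refine hf.comp ?_ ?_
      · simp only [circleMap]; fun_prop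
      · intro p hp
        have hp0 : 0 < p.1 := hr.trans_lt hp.1.1
        simpa [abs_of_pos hp0] using hp.1
    have h2 : ContinuousOn (fun p : ℝ × ℝ => ENNReal.ofReal p.1) (Ioo r R ×ˢ univ) :=
      (ENNReal.continuous_ofReal.comp continuous_fst).continuousOn
    intro p hp
    refine ENNReal.Tendsto.mul (h2 p hp) (Or.inl ?_) (h1 p hp) (Or.inr ENNReal.ofReal_ne_top)
    exact (ENNReal.ofReal_pos.mpr (hr.trans_lt hp.1.1)).ne'

/-- The density `1 / |z|²` is invariant under `z ↦ 1 / z`, which lets `e` and `1 / e` be treated on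
the same footing below. -/
theorem lintegral_annulus_inv_sq {r R : ℝ} (hr : 0 < r) (hrR : r ≤ R) :
    ∫⁻ z in {z : ℂ | r < ‖z‖ ∧ ‖z‖ < R}, ‖(z ^ 2)⁻¹‖ₑ =
      ENNReal.ofReal (2 * Real.pi * Real.log (R / r)) := by
  rw [lintegral_annulus_eq hr.le]
  · have h1 : ∀ ρ ∈ Ioo r R, ∫⁻ θ in Ioo (-Real.pi) Real.pi,
        ENNReal.ofReal ρ * ‖(circleMap 0 ρ θ ^ 2)⁻¹‖ₑ
          = ENNReal.ofReal (2 * Real.pi * ρ⁻¹) := by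
      intro ρ hρ
      have hρ0 : 0 < ρ := hr.trans hρ.1
      have : ∀ θ, ENNReal.ofReal ρ * ‖(circleMap 0 ρ θ ^ 2)⁻¹‖ₑ = ENNReal.ofReal ρ⁻¹ := by
        intro θ
        rw [← ofReal_norm, ← ENNReal.ofReal_mul hρ0.le]
        congr 1
        rw [norm_inv, norm_pow, norm_circleMap_zero, sq_abs]
        field_simp
      simp only [this]
      rw [setLIntegral_const, Real.volume_Ioo, ← ENNReal.ofReal_mul (by positivity)]
      congr 1; ring
    rw [setLIntegral_congr_fun measurableSet_Ioo h1, ← ofReal_integral_eq_lintegral_ofReal]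
    · congr 1
      rw [integral_const_mul, ← integral_Ioc_eq_integral_Ioo,
        ← intervalIntegral.integral_of_le hrR, integral_inv_of_pos hr (hr.trans_le hrR)]
    · refine Integrable.const_mul ?_ _
      refine (ContinuousOn.integrableOn_Icc ?_).mono_set Ioo_subset_Icc_self
      exact continuousOn_inv₀.mono fun ρ hρ => (hr.trans_le hρ.1).ne'
    · refine (ae_restrict_iff' measurableSet_Ioo).mpr (Eventually.of_forall fun ρ hρ => ?_)
      have : 0 < ρ := hr.trans hρ.1
      simp only [Pi.zero_apply]
      have := Real.pi_pos
      positivity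
  · refine continuous_enorm.comp_continuousOn (ContinuousOn.inv₀ (by fun_prop) ?_)
    intro z hz h
    have : z = 0 := by simpa using h
    rw [this] at hz
    simp at hz
    linarith [hz.1]

/-- A length-area inequality: if `H` is holomorphic in the disc and `H 0 = 1` then the
`|H|²`-weighted logarithmic area of an annulus is at least its logarithmic area. -/
theorem lintegral_annulus_inv_sq_le {H : ℂ → ℂ} (hH : DifferentiableOn ℂ H (ball 0 1))
    (hH0 : H 0 = 1) {r R : ℝ} (hr : 0 < r) (hR : R < 1) :
    ∫⁻ z in {z : ℂ | r < ‖z‖ ∧ ‖z‖ < R}, ‖(z ^ 2)⁻¹‖ₑ ≤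
      ∫⁻ z in {z : ℂ | r < ‖z‖ ∧ ‖z‖ < R}, ‖H z ^ 2‖ₑ * ‖(z ^ 2)⁻¹‖ₑ := by
  have hne : ∀ z ∈ {z : ℂ | r < ‖z‖ ∧ ‖z‖ < R}, z ^ 2 ≠ 0 := by
    intro z hz h
    have : z = 0 := by simpa using h
    rw [this] at hz
    simp at hz
    linarith [hz.1]
  have hsub : {z : ℂ | r < ‖z‖ ∧ ‖z‖ < R} ⊆ ball 0 1 := fun z hz =>
    mem_ball_zero_iff.mpr (hz.2.trans hR)
  have hc : ContinuousOn (fun z : ℂ => (z ^ 2)⁻¹) {z : ℂ | r < ‖z‖ ∧ ‖z‖ < R} :=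
    ContinuousOn.inv₀ (by fun_prop) hne
  have hc' : ContinuousOn (fun z : ℂ => ‖(z ^ 2)⁻¹‖ₑ) {z : ℂ | r < ‖z‖ ∧ ‖z‖ < R} :=
    continuous_enorm.comp_continuousOn hc
  rw [lintegral_annulus_eq hr.le hc', lintegral_annulus_eq hr.le]
  · refine setLIntegral_mono_ae' measurableSet_Ioo (Eventually.of_forall fun ρ hρ => ?_)
    have hρ0 : 0 < ρ := hr.trans hρ.1
    have hconst : ∀ θ, ‖(circleMap 0 ρ θ ^ 2)⁻¹‖ₑ = ENNReal.ofReal (ρ ^ 2)⁻¹ := by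
      intro θ
      rw [← ofReal_norm, norm_inv, norm_pow, norm_circleMap_zero, sq_abs]
    simp only [hconst]
    have hcomm : ∀ θ, ENNReal.ofReal ρ * (‖H (circleMap 0 ρ θ) ^ 2‖ₑ * ENNReal.ofReal (ρ ^ 2)⁻¹)
        = ENNReal.ofReal ρ * ENNReal.ofReal (ρ ^ 2)⁻¹ * ‖H (circleMap 0 ρ θ) ^ 2‖ₑ := fun θ => by ring
    simp only [hcomm]
    rw [lintegral_const_mul' _ _ (ENNReal.mul_ne_top ENNReal.ofReal_ne_top ENNReal.ofReal_ne_top),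
      setLIntegral_const]
    refine mul_le_mul' le_rfl ?_
    -- The mean value property for `H²` forces the integral of `|H|²` over each circle to be at
    -- least `2π`.
    have hav : Real.circleAverage (fun z => H z ^ 2) 0 ρ = 1 := by
      have : DiffContOnCl ℂ (fun z => H z ^ 2) (ball 0 |ρ|) := by
        refine DifferentiableOn.diffContOnCl ((hH.pow 2).mono ?_)
        refine closure_ball_subset_closedBall.trans (closedBall_subset_ball ?_)
        rw [abs_of_pos hρ0]; exact hρ.2.trans hR
      rw [this.circleAverage, hH0, one_pow]
    rw [Real.circleAverage_eq_integral_add (-Real.pi), intervalIntegral.integral_comp_add_right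
      (fun θ => H (circleMap 0 ρ θ) ^ 2), zero_add, show 2 * Real.pi + -Real.pi = Real.pi by ring,
      intervalIntegral.integral_of_le (by linarith [Real.pi_pos]),
      integral_Ioc_eq_integral_Ioo] at hav
    have hI : ∫ θ in Ioo (-Real.pi) Real.pi, H (circleMap 0 ρ θ) ^ 2 = ((2 * Real.pi : ℝ) : ℂ) := by
      rw [inv_smul_eq_iff₀ (by have := Real.pi_pos; positivity)] at hav
      rw [hav]; simp
    have := enorm_integral_le_lintegral_enorm (μ := volume.restrict (Ioo (-Real.pi) Real.pi))
      (fun θ => H (circleMap 0 ρ θ) ^ 2)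
    rw [hI] at this
    refine le_trans (le_of_eq ?_) this
    rw [Real.volume_Ioo, ← ofReal_norm, Complex.norm_real, Real.norm_of_nonneg
      (by have := Real.pi_pos; positivity)]
    congr 1; ring
  · have h1 := continuous_enorm.comp_continuousOn ((hH.continuousOn.mono hsub).pow 2)
    intro z hz
    exact ENNReal.Tendsto.mul (h1 z hz) (Or.inr enorm_ne_top) (hc' z hz) (Or.inr enorm_ne_top)

/-- Near a zero with derivative of modulus greater than `q`, a holomorphic function covers discs
of `q` times the radius. -/
theorem eventually_ball_subset_image {e : ℂ → ℂ} (he : AnalyticAt ℂ e 0) (he0 : e 0 = 0)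
    {q : ℝ} (hq : 0 < q) (hqe : q < ‖deriv e 0‖) :
    ∀ᶠ r in 𝓝[>] (0 : ℝ), ball 0 (q * r) ⊆ e '' ball 0 r := by
  have hst : HasStrictDerivAt e (deriv e 0) 0 := he.hasStrictDerivAt
  have hne : deriv e 0 ≠ 0 := norm_pos_iff.mp (hq.trans hqe)
  set g := hst.localInverse e (deriv e 0) 0 hne
  have hgd : HasStrictDerivAt g (deriv e 0)⁻¹ (e 0) := hst.to_localInverse hne
  have hgr : ∀ᶠ y in 𝓝 (e 0), e (g y) = y := hst.eventually_right_inverse hne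
  have hg0 : g 0 = 0 := by
    have := (hst.eventually_left_inverse hne).self_of_nhds
    rwa [he0] at this
  rw [he0] at hgd hgr
  have hslope := hasDerivAt_iff_tendsto_slope.mp hgd.hasDerivAt
  have hlt : ‖(deriv e 0)⁻¹‖ < q⁻¹ := by
    rw [norm_inv]; exact inv_strictAnti₀ hq hqe
  have hev := hslope.norm.eventually (gt_mem_nhds hlt)
  rw [eventually_nhdsWithin_iff] at hev
  obtain ⟨t, ht, hsub⟩ := Metric.eventually_nhds_iff_ball.mp (hev.and hgr)
  filter_upwards [Ioo_mem_nhdsGT (show 0 < t / q by positivity)] with r hr w hw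
  have hwt : w ∈ ball (0 : ℂ) t := by
    rw [mem_ball_zero_iff] at hw ⊢
    have := (lt_div_iff₀ hq).mp hr.2
    linarith
  refine ⟨g w, ?_, (hsub w hwt).2⟩
  rcases eq_or_ne w 0 with rfl | hw0
  · rw [hg0]; exact mem_ball_self hr.1
  · have h1 := (hsub w hwt).1 hw0
    rw [slope_def_field, hg0, sub_zero, sub_zero, norm_div,
      div_lt_iff₀ (norm_pos_iff.mpr hw0)] at h1
    rw [mem_ball_zero_iff] at hw ⊢
    refine h1.trans ?_
    rw [inv_mul_lt_iff₀ hq]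
    exact hw

/-- **Bieberbach–Eilenberg**: if `e` is univalent in the disc, `e 0 = 0` and the product of two
values of `e` is never `1`, then `‖e' 0‖ ≤ 1`. -/
theorem norm_deriv_le_one_of_mul_ne_one {e : ℂ → ℂ} (hd : DifferentiableOn ℂ e (ball 0 1))
    (hinj : InjOn e (ball 0 1)) (he0 : e 0 = 0)
    (hmul : ∀ z ∈ ball (0 : ℂ) 1, ∀ w ∈ ball (0 : ℂ) 1, e z * e w ≠ 1) :
    ‖deriv e 0‖ ≤ 1 := by
  -- Choose `1 < q < q' < ‖e' 0‖` and `R < 1` with `q * R > 1`. For small `r`, `e` covers the ball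
  -- of radius `q' * r` from within `ball 0 r`, so injectivity and the product condition keep `e`
  -- and `1 / e` above `q * r` on the annulus `r < |z| < R`. Their images are disjoint, lie in `q *
  -- r < |w| < 1 / (q * r)`, and each has logarithmic area at least `2π log (R / r)`. Comparing
  -- areas gives `R * q ≤ 1`, a contradiction.
  by_contra! hgt
  obtain ⟨q', hq'1, hq'⟩ := exists_between hgt
  obtain ⟨q, hq1, hqq'⟩ := exists_between hq'1
  have hq0 : 0 < q := one_pos.trans hq1
  obtain ⟨R, hRq, hR1⟩ := exists_between (inv_lt_one_of_one_lt₀ hq1)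
  have hR0 : 0 < R := (inv_pos.mpr hq0).trans hRq
  have h0mem : (0 : ℂ) ∈ ball (0 : ℂ) 1 := mem_ball_self one_pos
  have han : AnalyticAt ℂ e 0 := hd.analyticAt (isOpen_ball.mem_nhds h0mem)
  have ha0 : deriv e 0 ≠ 0 := norm_pos_iff.mp (one_pos.trans hgt)
  obtain ⟨r, hcov, hr0, hrR⟩ := ((eventually_ball_subset_image han he0
    (one_pos.trans (hq1.trans hqq')) hq').and
      (Ioo_mem_nhdsGT (show 0 < min R q⁻¹ by positivity))).exists
  have hrR' : r < R := hrR.trans_le (min_le_left _ _)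
  have hm1 : q * r < 1 := by
    have := hrR.trans_le (min_le_right _ _)
    rwa [lt_inv_comm₀ hr0 hq0, ← one_div, lt_div_iff₀ hr0] at this
  have hm0 : 0 < q * r := by positivity
  set A : Set ℂ := {z : ℂ | r < ‖z‖ ∧ ‖z‖ < R} with hAdef
  have hAm : MeasurableSet A :=
    (measurableSet_lt measurable_const measurable_norm).inter
      (measurableSet_lt measurable_norm measurable_const)
  have hA1 : A ⊆ ball 0 1 := fun z hz => mem_ball_zero_iff.mpr (hz.2.trans hR1)
  have hr1 : ball (0 : ℂ) r ⊆ ball 0 1 := ball_subset_ball (hrR'.trans hR1).le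
  have hAne : ∀ z ∈ A, z ≠ 0 := by
    rintro z hz rfl
    have := hz.1; rw [norm_zero] at this; linarith
  have hene : ∀ z ∈ ball (0 : ℂ) 1, z ≠ 0 → e z ≠ 0 := fun z hz hz0 h =>
    hz0 (hinj hz h0mem (h.trans he0.symm))
  have hder : ∀ z ∈ A, HasDerivAt e (deriv e z) z := fun z hz =>
    (hd.differentiableAt (isOpen_ball.mem_nhds (hA1 hz))).hasDerivAt
  have hder' : ∀ z ∈ A, HasDerivAt (fun z => (e z)⁻¹) (-deriv e z / e z ^ 2) z := fun z hz =>
    (hder z hz).fun_inv (hene z (hA1 hz) (hAne z hz))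
  have hinjA : InjOn e A := hinj.mono hA1
  have hinjA' : InjOn (fun z => (e z)⁻¹) A := fun a ha b hb h => hinjA ha hb (inv_injective h)
  -- values in the annulus
  have hlow : ∀ z ∈ A, q * r < ‖e z‖ := by
    intro z hz
    by_contra! hle
    obtain ⟨v, hv, hvz⟩ := hcov (show e z ∈ ball 0 (q' * r) by
      rw [mem_ball_zero_iff]; exact hle.trans_lt (by gcongr))
    have := hinj (hr1 hv) (hA1 hz) hvz
    rw [this, mem_ball_zero_iff] at hv
    exact lt_asymm hv hz.1
  have hup : ∀ z ∈ A, q * r < ‖(e z)⁻¹‖ := by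
    intro z hz
    by_contra! hle
    obtain ⟨v, hv, hvz⟩ := hcov (show (e z)⁻¹ ∈ ball 0 (q' * r) by
      rw [mem_ball_zero_iff]; exact hle.trans_lt (by gcongr))
    refine hmul v (hr1 hv) z (hA1 hz) ?_
    rw [hvz, inv_mul_cancel₀ (hene z (hA1 hz) (hAne z hz))]
  set N : Set ℂ := {w : ℂ | q * r < ‖w‖ ∧ ‖w‖ < (q * r)⁻¹} with hNdef
  have hinvlt : ∀ w : ℂ, q * r < ‖w⁻¹‖ → ‖w‖ < (q * r)⁻¹ := by
    intro w hw
    rw [norm_inv] at hw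
    exact (lt_inv_comm₀ hm0 (inv_pos.mp (hm0.trans hw))).mp hw
  have hsub : e '' A ∪ (fun z => (e z)⁻¹) '' A ⊆ N := by
    rintro _ (⟨z, hz, rfl⟩ | ⟨z, hz, rfl⟩)
    · exact ⟨hlow z hz, hinvlt _ (hup z hz)⟩
    · exact ⟨hup z hz, hinvlt _ (by simpa using hlow z hz)⟩
  have hdisj : Disjoint (e '' A) ((fun z => (e z)⁻¹) '' A) := by
    rw [Set.disjoint_left]
    rintro _ ⟨z, hz, rfl⟩ ⟨w, hw, h⟩
    refine hmul z (hA1 hz) w (hA1 hw) ?_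
    rw [← h]; exact inv_mul_cancel₀ (hene w (hA1 hw) (hAne w hw))
  have hmeas : MeasurableSet ((fun z => (e z)⁻¹) '' A) :=
    hAm.image_of_continuousOn_injOn
      (fun z hz => (hder' z hz).continuousAt.continuousWithinAt) hinjA'
  -- the function `z e'(z) / e(z)`
  set H : ℂ → ℂ := fun z => deriv e z / dslope e 0 z with hHdef
  have hds : ∀ z ∈ ball (0 : ℂ) 1, dslope e 0 z ≠ 0 := by
    intro z hz
    rcases eq_or_ne z 0 with rfl | hz0
    · rwa [dslope_same]
    · rw [dslope_of_ne _ hz0, slope_def_field, he0, sub_zero, sub_zero]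
      exact div_ne_zero (hene z hz hz0) hz0
  have hHd : DifferentiableOn ℂ H (ball 0 1) :=
    (hd.deriv isOpen_ball).div
      ((Complex.differentiableOn_dslope (isOpen_ball.mem_nhds h0mem)).mpr hd) hds
  have hH0 : H 0 = 1 := by rw [hHdef]; simp only [dslope_same]; exact div_self ha0
  have hHA : ∀ z ∈ A, H z = z * deriv e z / e z := by
    intro z hz
    rw [hHdef]
    simp only [dslope_of_ne _ (hAne z hz), slope_def_field, he0, sub_zero]
    rw [div_div_eq_mul_div, mul_comm]
  have hint₁ : ∫⁻ w in e '' A, ‖(w ^ 2)⁻¹‖ₑ = ∫⁻ z in A, ‖H z ^ 2‖ₑ * ‖(z ^ 2)⁻¹‖ₑ := by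
    rw [lintegral_image_of_hasDerivAt hAm hder hinjA]
    refine setLIntegral_congr_fun hAm fun z hz => ?_
    have := hAne z hz
    have := hene z (hA1 hz) this
    simp only [← enorm_mul, hHA z hz]
    congr 1
    field_simp
  have hint₂ : ∫⁻ w in (fun z => (e z)⁻¹) '' A, ‖(w ^ 2)⁻¹‖ₑ
      = ∫⁻ z in A, ‖H z ^ 2‖ₑ * ‖(z ^ 2)⁻¹‖ₑ := by
    rw [lintegral_image_of_hasDerivAt hAm hder' hinjA']
    refine setLIntegral_congr_fun hAm fun z hz => ?_
    have := hAne z hz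
    have := hene z (hA1 hz) this
    simp only [← enorm_mul, hHA z hz]
    congr 1
    field_simp
  have hlower := lintegral_annulus_inv_sq_le hHd hH0 hr0 hR1
  have hupper : ∫⁻ w in e '' A ∪ (fun z => (e z)⁻¹) '' A, ‖(w ^ 2)⁻¹‖ₑ
      ≤ ∫⁻ w in N, ‖(w ^ 2)⁻¹‖ₑ := lintegral_mono_set hsub
  rw [lintegral_union hmeas hdisj, hint₁, hint₂] at hupper
  have hfin := (add_le_add hlower hlower).trans hupper
  have hlog : 0 ≤ Real.log (R / r) := Real.log_nonneg ((one_le_div hr0).mpr hrR'.le)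
  have hpi := Real.pi_pos
  rw [lintegral_annulus_inv_sq hr0 hrR'.le,
    lintegral_annulus_inv_sq hm0 (hm1.le.trans ((one_le_inv₀ hm0).mpr hm1.le)),
    ← ENNReal.ofReal_add (by positivity) (by positivity)] at hfin
  have hlogm : 0 ≤ Real.log ((q * r)⁻¹ / (q * r)) :=
    Real.log_nonneg ((one_le_div hm0).mpr (hm1.le.trans ((one_le_inv₀ hm0).mpr hm1.le)))
  rw [ENNReal.ofReal_le_ofReal_iff (by positivity)] at hfin
  have h1 : 2 * Real.log (R / r) ≤ Real.log ((q * r)⁻¹ / (q * r)) := by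
    nlinarith
  rw [Real.log_div hR0.ne' hr0.ne', Real.log_div (inv_ne_zero hm0.ne') hm0.ne', Real.log_inv,
    Real.log_mul hq0.ne' hr0.ne'] at h1
  have h2 : Real.log (R * q) ≤ 0 := by
    rw [Real.log_mul hR0.ne' hq0.ne']; linarith
  have h3 : 1 < R * q := by
    rwa [inv_lt_iff_one_lt_mul₀ hq0] at hRq
  exact absurd h2 (not_le.mpr (Real.log_pos h3))

/-! ### Koebe constants: 4 in general, 2 for convex domains. -/

/-- Every univalent map of the unit disc into `D` satisfies a Koebe-type distortion bound with
constant `c`. -/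
def KoebeBound (D : Set ℂ) (c : ℝ) : Prop :=
  ∀ f : ℂ → ℂ, DifferentiableOn ℂ f (ball 0 1) → InjOn f (ball 0 1) → MapsTo f (ball 0 1) D →
    ∀ p ∉ D, ‖deriv f 0‖ ≤ c * ‖f 0 - p‖

/-- The **Koebe quarter theorem**. -/
theorem koebeBound_four (D : Set ℂ) : KoebeBound D 4 := by
  intro f hd hinj hmaps p hp
  have h0mem : (0 : ℂ) ∈ ball (0 : ℂ) 1 := mem_ball_self one_pos
  have hsc : IsSimplyConnected (ball (0 : ℂ) 1) := by
    have : ContractibleSpace (ball (0 : ℂ) 1) :=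
      (convex_ball (0 : ℂ) 1).contractibleSpace ⟨0, h0mem⟩
    exact SimplyConnectedSpace.ofContractible _
  have hne : ∀ z ∈ ball (0 : ℂ) 1, f z - p ≠ 0 := fun z hz h =>
    hp (sub_eq_zero.mp h ▸ hmaps hz)
  -- With `s² = f - p` and `q = s 0`, put `e = (s - q) / (s + q)`. Then `e z * e w = 1` would force
  -- `s z = -s w`, which is impossible, and `e' 0 = f' 0 / (4 (f 0 - p))`.
  obtain ⟨s, hscont, hsq⟩ := Complex.exists_continuousOn_pow_eq hsc isOpen_ball
    (g := fun z => f z - p) (hd.continuousOn.sub continuousOn_const)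
    (by rintro ⟨z, hz, h⟩; exact hne z hz h) two_ne_zero
  have hs0 : ∀ z ∈ ball (0 : ℂ) 1, s z ≠ 0 := fun z hz h =>
    hne z hz (by rw [← hsq z, h]; simp)
  have hsd : ∀ z ∈ ball (0 : ℂ) 1, HasDerivAt s (deriv f z / (2 * s z)) z := fun z hz =>
    hasDerivAt_of_sq_eq isOpen_ball hscont (fun z _ => hsq z) hz
      ((hd.differentiableAt (isOpen_ball.mem_nhds hz)).hasDerivAt.sub_const p) (hne z hz)
  have hsinj : ∀ a ∈ ball (0 : ℂ) 1, ∀ b ∈ ball (0 : ℂ) 1, s a ^ 2 = s b ^ 2 → a = b :=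
    fun a ha b hb h => by
      rw [hsq, hsq] at h; exact hinj ha hb (sub_left_injective h)
  have hneg : ∀ a ∈ ball (0 : ℂ) 1, ∀ b ∈ ball (0 : ℂ) 1, s a + s b ≠ 0 := by
    intro a ha b hb h
    have hab := hsinj a ha b hb (by rw [eq_neg_of_add_eq_zero_left h, neg_sq])
    subst hab
    rw [← two_mul] at h
    exact hs0 a ha ((mul_eq_zero.mp h).resolve_left two_ne_zero)
  set q := s 0
  have hq : q ≠ 0 := hs0 0 h0mem
  have hed : ∀ z ∈ ball (0 : ℂ) 1, HasDerivAt (fun z => (s z - q) / (s z + q))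
      ((deriv f z / (2 * s z) * (s z + q) - (s z - q) * (deriv f z / (2 * s z))) / (s z + q) ^ 2)
      z := fun z hz =>
    ((hsd z hz).sub_const q).div ((hsd z hz).add_const q) (hneg z hz 0 h0mem)
  have key := norm_deriv_le_one_of_mul_ne_one (e := fun z => (s z - q) / (s z + q))
    (fun z hz => (hed z hz).differentiableAt.differentiableWithinAt) ?_ (by simp [q]) ?_
  · rw [(hed 0 h0mem).deriv] at key
    have e1 : (deriv f 0 / (2 * s 0) * (s 0 + q) - (s 0 - q) * (deriv f 0 / (2 * s 0)))
        / (s 0 + q) ^ 2 = deriv f 0 / (4 * (f 0 - p)) := by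
      rw [← hsq 0]
      change (deriv f 0 / (2 * q) * (q + q) - (q - q) * (deriv f 0 / (2 * q))) / (q + q) ^ 2
        = deriv f 0 / (4 * q ^ 2)
      field_simp
      ring
    rw [e1, norm_div, norm_mul, div_le_one (mul_pos (by simp) (norm_pos_iff.mpr (hne 0 h0mem)))]
      at key
    simpa using key
  · intro a ha b hb hab
    simp only at hab
    rw [div_eq_div_iff (hneg a ha 0 h0mem) (hneg b hb 0 h0mem)] at hab
    have : 2 * q * (s a - s b) = 0 := by linear_combination hab
    have := (mul_eq_zero.mp this).resolve_left (mul_ne_zero two_ne_zero hq)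
    exact hsinj a ha b hb (by rw [sub_eq_zero.mp this])
  · intro a ha b hb hab
    rw [div_mul_div_comm, div_eq_one_iff_eq
      (mul_ne_zero (hneg a ha 0 h0mem) (hneg b hb 0 h0mem))] at hab
    have : 2 * q * (s a + s b) = 0 := by linear_combination -hab
    exact hneg a ha b hb ((mul_eq_zero.mp this).resolve_left (mul_ne_zero two_ne_zero hq))

/-- A half-plane contains `D` and has `p` outside it or on its boundary. Composing `f` with the
Cayley map of the half-plane based at `f 0` and applying Schwarz gives the constant 2. -/
theorem koebeBound_two_of_convex {D : Set ℂ} (hD : IsOpen D) (hconv : Convex ℝ D) :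
    KoebeBound D 2 := by
  intro f hd _ hmaps p hp
  have h0mem : (0 : ℂ) ∈ ball (0 : ℂ) 1 := mem_ball_self one_pos
  obtain ⟨l, hl⟩ := geometric_hahn_banach_open_point hconv hD hp
  -- The number `c` represents the real functional: `l z = Re (c z)`.
  set c : ℂ := ⟨l 1, -l Complex.I⟩ with hc
  have hlc : ∀ z : ℂ, l z = (c * z).re := by
    intro z
    have : z = z.re • (1 : ℂ) + z.im • Complex.I := by simp
    conv_lhs => rw [this]
    rw [map_add, map_smul, map_smul, Complex.mul_re]
    simp [hc]
    ring
  set u : ℂ → ℂ := fun z => c * (p - f z) with hu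
  have hure : ∀ z ∈ ball (0 : ℂ) 1, 0 < (u z).re := by
    intro z hz
    have := hl (f z) (hmaps hz)
    rw [hlc, hlc] at this
    simp only [hu, mul_sub, Complex.sub_re]
    linarith
  have hu0 := hure 0 h0mem
  have hc0 : c ≠ 0 := by
    intro h
    simp [hu, h] at hu0
  set v := starRingEnd ℂ (u 0) with hv
  have hne : ∀ z ∈ ball (0 : ℂ) 1, u z + v ≠ 0 := by
    intro z hz h
    have h1 := congrArg Complex.re h
    simp only [hv, Complex.add_re, Complex.conj_re, Complex.zero_re] at h1
    linarith [hure z hz]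
  have hud : ∀ z ∈ ball (0 : ℂ) 1, HasDerivAt u (c * (-deriv f z)) z := fun z hz =>
    ((hd.differentiableAt (isOpen_ball.mem_nhds hz)).hasDerivAt.const_sub p).const_mul c
  have hed : ∀ z ∈ ball (0 : ℂ) 1, HasDerivAt (fun z => (u z - u 0) / (u z + v))
      ((c * (-deriv f z) * (u z + v) - (u z - u 0) * (c * (-deriv f z))) / (u z + v) ^ 2) z :=
    fun z hz => ((hud z hz).sub_const _).div ((hud z hz).add_const v) (hne z hz)
  have key := Complex.norm_deriv_le_one_of_mapsTo_ball (f := fun z => (u z - u 0) / (u z + v))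
    (fun z hz => (hed z hz).differentiableAt.differentiableWithinAt) ?_ one_pos
  · have h2 : u 0 + v = ((2 * (u 0).re : ℝ) : ℂ) := by rw [hv, Complex.add_conj]
    rw [(hed 0 h0mem).deriv, sub_self, zero_mul, sub_zero, pow_two, mul_div_mul_right _ _
      (hne 0 h0mem), norm_div, h2, Complex.norm_real, Real.norm_of_nonneg (by positivity),
      div_le_one (by positivity), norm_mul, norm_neg] at key
    have h3 : (u 0).re ≤ ‖c‖ * ‖f 0 - p‖ := by
      rw [norm_sub_rev, ← norm_mul]; exact Complex.re_le_norm _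
    have hcp : 0 < ‖c‖ := norm_pos_iff.mpr hc0
    refine le_of_mul_le_mul_left ?_ hcp
    linarith
  · intro z hz
    simp only [sub_self, zero_div]
    rw [mem_closedBall_zero_iff, norm_div, div_le_one (norm_pos_iff.mpr (hne z hz))]
    refine le_of_sq_le_sq ?_ (norm_nonneg _)
    simp only [← Complex.normSq_eq_norm_sq, Complex.normSq_apply, hv, Complex.add_re,
      Complex.add_im, Complex.sub_re, Complex.sub_im, Complex.conj_re, Complex.conj_im]
    nlinarith [mul_pos (hure z hz) hu0]

/-! ### Lower bounds for real Riemann maps on the segment. -/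

theorem IsUnivalentToDisc.exists_inverse {D : Set ℂ} (hD : IsOpen D) {B : ℂ → ℂ}
    (hB : IsUnivalentToDisc D B) (hsurj : SurjOn B D (ball 0 1)) :
    ∃ G : ℂ → ℂ, MapsTo G (ball 0 1) D ∧ (∀ w ∈ ball (0 : ℂ) 1, B (G w) = w) ∧
      (∀ z ∈ D, G (B z) = z) ∧ ∀ z ∈ D, HasDerivAt G (deriv B z)⁻¹ (B z) := by
  have hleft : ∀ z ∈ D, Function.invFunOn B D (B z) = z := fun z hz =>
    hB.injOn.leftInvOn_invFunOn hz
  refine ⟨Function.invFunOn B D, hsurj.mapsTo_invFunOn,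
    fun w hw => hsurj.rightInvOn_invFunOn hw, hleft, fun z hz => ?_⟩
  exact ((hB.differentiableOn.analyticAt (hD.mem_nhds hz)).hasStrictDerivAt.to_local_left_inverse
    (hB.deriv_ne_zero z hz) (by filter_upwards [hD.mem_nhds hz] using hleft)).hasDerivAt

/-- The Koebe bound is applied to the inverse of `B` precomposed with the automorphism sending `0`
to `B y`; that map sends `0` to `y` and has derivative of modulus `(1 - ‖B y‖²) / ‖B' y‖` there. -/
theorem IsUnivalentToDisc.one_sub_norm_sq_le {D : Set ℂ} (hD : IsOpen D) {B : ℂ → ℂ}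
    (hB : IsUnivalentToDisc D B) (hsurj : SurjOn B D (ball 0 1)) {c : ℝ} (hc : KoebeBound D c)
    {y p : ℂ} (hy : y ∈ D) (hp : p ∉ D) :
    1 - ‖B y‖ ^ 2 ≤ c * ‖deriv B y‖ * ‖y - p‖ := by
  obtain ⟨G, hGm, hBG, hGB, hGd⟩ := hB.exists_inverse hD hsurj
  have hb : ‖B y‖ < 1 := mem_ball_zero_iff.mp (hB.mapsTo hy)
  have hnb : ‖-B y‖ < 1 := by rwa [norm_neg]
  have h00 : ‖(0 : ℂ)‖ < 1 := by simp
  have hGd' : ∀ w ∈ ball (0 : ℂ) 1, DifferentiableAt ℂ G w := fun w hw => by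
    have := (hGd (G w) (hGm hw)).differentiableAt
    rwa [hBG w hw] at this
  have hz0 : discAut (-B y) 0 = B y := by rw [discAut_zero, neg_neg]
  have hder : HasDerivAt (fun z => G (discAut (-B y) z))
      ((deriv B y)⁻¹ * ((1 - starRingEnd ℂ (-B y) * (-B y))
        / (1 - starRingEnd ℂ (-B y) * 0) ^ 2)) 0 := by
    refine HasDerivAt.comp (0 : ℂ) ?_ (hasDerivAt_discAut hnb h00)
    rw [hz0]; exact hGd y hy
  have key := hc (fun z => G (discAut (-B y) z)) ?_ ?_ (hGm.comp (discAut_mapsTo hnb)) p hp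
  · rw [hder.deriv, hz0, hGB y hy, norm_mul, norm_inv, inv_mul_le_iff₀
      (norm_pos_iff.mpr (hB.deriv_ne_zero y hy)), mul_zero, sub_zero, one_pow, div_one,
      map_neg, neg_mul_neg, mul_comm (starRingEnd ℂ _), Complex.mul_conj,
      Complex.normSq_eq_norm_sq] at key
    have e : ‖1 - ((‖B y‖ ^ 2 : ℝ) : ℂ)‖ = 1 - ‖B y‖ ^ 2 := by
      norm_cast
      rw [Real.norm_of_nonneg]
      nlinarith [norm_nonneg (B y)]
    rw [e] at key
    linarith
  · intro z hz
    exact ((hGd' _ (discAut_mapsTo hnb hz)).comp z (hasDerivAt_discAut hnb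
      (mem_ball_zero_iff.mp hz)).differentiableAt).differentiableWithinAt
  · intro z hz w hw h
    refine injOn_discAut hnb hz hw ?_
    rw [← hBG _ (discAut_mapsTo hnb hz), ← hBG _ (discAut_mapsTo hnb hw)]
    exact congrArg B h

/-- The Riemann map of a symmetric domain, normalised at a real point, is real on the reals. -/
theorem IsNiceDomain.exists_real_riemannMap {D : Set ℂ} (hD : IsNiceDomain D) (hne : D ≠ univ)
    {x : ℝ} (hx : (x : ℂ) ∈ D) :
    ∃ B, IsUnivalentToDisc D B ∧ SurjOn B D (ball 0 1) ∧ B x = 0 ∧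
      (∀ t : ℝ, (t : ℂ) ∈ D → (B t).im = 0) ∧ 0 < (deriv B x).re := by
  obtain ⟨f, hf, hfx, hfs⟩ := exists_riemannMap hD.isOpen hD.isSimplyConnected hne hx
  have hM : 0 < ‖deriv f x‖ := norm_pos_iff.mpr (hf.deriv_ne_zero x hx)
  set c : ℂ := ‖deriv f x‖ / deriv f x with hc
  have hc1 : ‖c‖ = 1 := by
    rw [hc, norm_div, Complex.norm_real, norm_norm, div_self hM.ne']
  have hc0 : c ≠ 0 := norm_pos_iff.mp (by rw [hc1]; exact one_pos)
  have hdc : ∀ z ∈ D, HasDerivAt (fun z => c * f z) (c * deriv f z) z := fun z hz =>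
    (hf.differentiableOn.differentiableAt (hD.isOpen.mem_nhds hz)).hasDerivAt.const_mul c
  set B : ℂ → ℂ := fun z => c * f z with hBdef
  have hB : IsUnivalentToDisc D B := by
    refine ⟨fun z hz => (hdc z hz).differentiableAt.differentiableWithinAt, ?_, ?_, ?_⟩
    · intro z hz
      rw [mem_ball_zero_iff, norm_mul, hc1, one_mul]
      exact mem_ball_zero_iff.mp (hf.mapsTo hz)
    · intro a ha b hb h
      exact hf.injOn ha hb (mul_left_cancel₀ hc0 h)
    · intro z hz
      rw [(hdc z hz).deriv]
      exact mul_ne_zero hc0 (hf.deriv_ne_zero z hz)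
  have hBs : SurjOn B D (ball 0 1) := by
    intro w hw
    obtain ⟨z, hz, hzw⟩ := hfs (show w / c ∈ ball (0 : ℂ) 1 by
      rw [mem_ball_zero_iff, norm_div, hc1, div_one]; exact mem_ball_zero_iff.mp hw)
    exact ⟨z, hz, by simp only [hBdef, hzw]; exact mul_div_cancel₀ _ hc0⟩
  have hBx : B x = 0 := by simp [hBdef, hfx]
  have hBx' : deriv B x = (‖deriv f x‖ : ℂ) := by
    rw [(hdc x hx).deriv, hc, div_mul_cancel₀ _ (hf.deriv_ne_zero x hx)]
  refine ⟨B, hB, hBs, hBx, ?_, by rw [hBx', Complex.ofReal_re]; exact hM⟩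
  obtain ⟨G, hGm, hBG, hGB, hGd⟩ := hB.exists_inverse hD.isOpen hBs
  -- The reflected map read in the disc fixes `0` with derivative `1`, so it is the identity by the
  -- equality case of Schwarz; thus `B` commutes with conjugation.
  set φ : ℂ → ℂ := fun w => starRingEnd ℂ (B (starRingEnd ℂ (G w))) with hφ
  have hBc : ∀ z ∈ D, HasDerivAt (fun z => starRingEnd ℂ (B (starRingEnd ℂ z)))
      (starRingEnd ℂ (deriv B (starRingEnd ℂ z))) z := by
    intro z hz
    have := (hB.differentiableOn.differentiableAt
      (hD.isOpen.mem_nhds (hD.conj_mem z hz))).hasDerivAt.conj_conj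
    rw [Complex.conj_conj] at this
    exact this
  have hφd : ∀ w ∈ ball (0 : ℂ) 1, HasDerivAt φ
      (starRingEnd ℂ (deriv B (starRingEnd ℂ (G w))) * (deriv B (G w))⁻¹) w := by
    intro w hw
    have h1 := hGd (G w) (hGm hw)
    rw [hBG w hw] at h1
    exact (hBc (G w) (hGm hw)).comp w h1
  have h0mem : (0 : ℂ) ∈ ball (0 : ℂ) 1 := mem_ball_self one_pos
  have hG0 : G 0 = x := by rw [← hBx, hGB x hx]
  have hφ0 : φ 0 = 0 := by simp [hφ, hG0, hBx]
  have hφ'0 : deriv φ 0 = 1 := by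
    rw [(hφd 0 h0mem).deriv, hG0, Complex.conj_ofReal, hBx', Complex.conj_ofReal]
    exact mul_inv_cancel₀ (by exact_mod_cast hM.ne')
  have hid := Complex.affine_of_mapsTo_ball_of_norm_dslope_eq_div (f := φ) (c := 0) (R₁ := 1)
    (R₂ := 1) (z₀ := 0) (fun w hw => (hφd w hw).differentiableAt.differentiableWithinAt)
    (by
      intro w hw
      rw [hφ0, mem_closedBall_zero_iff, hφ, RCLike.norm_conj]
      exact (mem_ball_zero_iff.mp (hB.mapsTo (hD.conj_mem _ (hGm hw)))).le)
    h0mem (by rw [dslope_same, hφ'0]; simp)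
  intro t ht
  have h1 := hid (hB.mapsTo ht)
  have h2 : φ (B t) = starRingEnd ℂ (B t) := by simp only [hφ, hGB _ ht, Complex.conj_ofReal]
  simp only [h2, dslope_same, hφ'0, hφ0, zero_add, sub_zero, smul_eq_mul, mul_one] at h1
  exact Complex.conj_eq_iff_im.mp h1

/-- Growth of a real function whose hyperbolic speed is bounded below. -/
theorem div_add_le_of_one_sub_sq_le {β β' : ℝ → ℝ} {x t C : ℝ} (hC : 0 < C) (hxt : x ≤ t)
    (hd : ∀ y ∈ Icc x t, HasDerivAt β (β' y) y) (hx : β x = 0) (hlt : ∀ y ∈ Icc x t, β y < 1)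
    (hpos : ∀ y ∈ Icc x t, 0 < β' y) (h : ∀ y ∈ Icc x t, 1 - β y ^ 2 ≤ C * β' y) :
    (t - x) / (C + (t - x)) ≤ β t := by
  have hcont : ContinuousOn β (Icc x t) := fun y hy => (hd y hy).continuousAt.continuousWithinAt
  have hmono : MonotoneOn β (Icc x t) := by
    refine monotoneOn_of_deriv_nonneg (convex_Icc x t) hcont ?_ ?_
    · exact fun y hy => (hd y (interior_subset hy)).differentiableAt.differentiableWithinAt
    · intro y hy
      rw [(hd y (interior_subset hy)).deriv]; exact (hpos y (interior_subset hy)).le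
  have hnn : ∀ y ∈ Icc x t, 0 ≤ β y := fun y hy => by
    rw [← hx]; exact hmono (left_mem_Icc.mpr hxt) hy hy.1
  -- For `β ≥ 0` the hypothesis gives `β' / (1 - β)² ≥ (1 + β) / (C (1 - β)) ≥ 1 / C`, so `β / (1 -
  -- β)` grows at least linearly.
  have hψ : ∀ y ∈ Icc x t, HasDerivAt (fun y => β y / (1 - β y)) (β' y / (1 - β y) ^ 2) y := by
    intro y hy
    convert! (hd y hy).div ((hd y hy).const_sub 1) (sub_pos.mpr (hlt y hy)).ne' using 1
    ring
  have hmv := (convex_Icc x t).mul_sub_le_image_sub_of_le_deriv (C := 1 / C)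
    (fun y hy => (hψ y hy).continuousAt.continuousWithinAt)
    (fun y hy => (hψ y (interior_subset hy)).differentiableAt.differentiableWithinAt)
    (fun y hy => by
      have hy' := interior_subset hy
      rw [(hψ y hy').deriv, div_le_div_iff₀ hC (by have := sub_pos.mpr (hlt y hy'); positivity)]
      nlinarith [h y hy', hnn y hy', hlt y hy'])
    x (left_mem_Icc.mpr hxt) t (right_mem_Icc.mpr hxt) hxt
  have h1 : 0 < 1 - β t := sub_pos.mpr (hlt t (right_mem_Icc.mpr hxt))
  rw [hx, zero_div, sub_zero, one_div, inv_mul_le_iff₀ hC, ← mul_div_assoc, le_div_iff₀ h1] at hmv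
  rw [div_le_iff₀ (by linarith)]
  linarith

theorem infDist_le_deltaDom (D : Set ℂ) {y : ℝ} (hy : y ∈ Icc (-1 : ℝ) 1) :
    infDist (y : ℂ) Dᶜ ≤ deltaDom D := by
  have hc : Continuous fun t : ℝ => infDist (t : ℂ) Dᶜ :=
    (continuous_infDist_pt _).comp Complex.continuous_ofReal
  exact le_csSup (isCompact_Icc.image hc).bddAbove (mem_image_of_mem _ hy)

theorem deltaDom_pos {D : Set ℂ} (hD : IsOpen D) (hne : D ≠ univ) (h0 : (0 : ℂ) ∈ D) :
    0 < deltaDom D := by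
  refine lt_of_lt_of_le ?_ (infDist_le_deltaDom D (y := 0) (by simp))
  rw [Complex.ofReal_zero]
  exact (hD.isClosed_compl.notMem_iff_infDist_pos (nonempty_compl.mpr hne)).mp (by simpa using h0)

/-- For every node there is a holomorphic map into the disc, real on the reals, vanishing at the
node and not too small on `[-1, 1]`. -/
theorem IsNiceDomain.exists_map_lower_bound {D : Set ℂ} (hD : IsNiceDomain D) (hne : D ≠ univ)
    (hseg : ∀ t : ℝ, t ∈ Icc (-1 : ℝ) 1 → (t : ℂ) ∈ D) {c : ℝ} (hc0 : 0 < c)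
    (hc : KoebeBound D c) {x : ℝ} (hx : x ∈ Icc (-1 : ℝ) 1) :
    ∃ B : ℂ → ℂ, DifferentiableOn ℂ B D ∧ MapsTo B D (ball 0 1) ∧ B x = 0 ∧
      (∀ t : ℝ, (t : ℂ) ∈ D → (B t).im = 0) ∧
      ∀ t ∈ Icc (-1 : ℝ) 1, |t - x| / (c * deltaDom D + |t - x|) ≤ |(B t).re| := by
  obtain ⟨B, hB, hBs, hBx, hBr, hBx'⟩ := hD.exists_real_riemannMap hne (hseg x hx)
  refine ⟨B, hB.differentiableOn, hB.mapsTo, hBx, hBr, ?_⟩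
  have hδ : 0 < deltaDom D := deltaDom_pos hD.isOpen hne (by simpa using hseg 0 (by simp))
  set C := c * deltaDom D with hCdef
  have hC : 0 < C := mul_pos hc0 hδ
  have hd : ∀ y ∈ Icc (-1 : ℝ) 1, HasDerivAt B (deriv B y) y := fun y hy =>
    (hB.differentiableOn.differentiableAt (hD.isOpen.mem_nhds (hseg y hy))).hasDerivAt
  have hdim : ∀ y ∈ Icc (-1 : ℝ) 1, (deriv B y).im = 0 := by
    intro y hy
    have h1 := Complex.imCLM.hasFDerivAt.comp_hasDerivAt y (hd y hy).comp_ofReal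
    have h2 : (Complex.imCLM ∘ fun t : ℝ => B t) =ᶠ[𝓝 y] fun _ => 0 := by
      have : ∀ᶠ t : ℝ in 𝓝 y, (t : ℂ) ∈ D :=
        Complex.continuous_ofReal.continuousAt.eventually (hD.isOpen.mem_nhds (hseg y hy))
      filter_upwards [this] with t ht using hBr t ht
    exact h1.unique ((hasDerivAt_const y (0 : ℝ)).congr_of_eventuallyEq h2)
  have hβ : ∀ y ∈ Icc (-1 : ℝ) 1,
      HasDerivAt (fun t : ℝ => (B t).re) (deriv B y).re y := fun y hy =>
    (hd y hy).real_of_complex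
  have hne0 : ∀ y ∈ Icc (-1 : ℝ) 1, (deriv B y).re ≠ 0 := fun y hy h =>
    hB.deriv_ne_zero y (hseg y hy) (Complex.ext h (hdim y hy))
  have hcont : ContinuousOn (fun y : ℝ => (deriv B y).re) (Icc (-1) 1) := by
    refine Complex.continuous_re.comp_continuousOn ?_
    exact (hB.differentiableOn.deriv hD.isOpen).continuousOn.comp
      Complex.continuous_ofReal.continuousOn hseg
  -- On the segment `B'` is real, continuous and never zero, hence keeps the sign it has at `x`.
  have hpos : ∀ y ∈ Icc (-1 : ℝ) 1, 0 < (deriv B y).re := by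
    intro y hy
    by_contra! hle
    obtain ⟨z, hz, hz0⟩ := isPreconnected_Icc.intermediate_value hy hx hcont ⟨hle, hBx'.le⟩
    exact hne0 z hz hz0
  have hnorm : ∀ y ∈ Icc (-1 : ℝ) 1, ‖B y‖ ^ 2 = (B y).re ^ 2 := by
    intro y hy
    rw [← Complex.normSq_eq_norm_sq, Complex.normSq_apply, hBr y (hseg y hy)]; ring
  have hspeed : ∀ y ∈ Icc (-1 : ℝ) 1, 1 - (B y).re ^ 2 ≤ C * (deriv B y).re := by
    intro y hy
    obtain ⟨p, hp, hpd⟩ := hD.isOpen.isClosed_compl.exists_infDist_eq_dist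
      (nonempty_compl.mpr hne) (y : ℂ)
    have h1 := hB.one_sub_norm_sq_le hD.isOpen hBs hc (hseg y hy) hp
    have h2 : ‖deriv B y‖ = (deriv B y).re := by
      rw [show deriv B y = ((deriv B y).re : ℂ) from Complex.ext rfl (by simp [hdim y hy]),
        Complex.norm_real, Real.norm_of_nonneg (by simpa using (hpos y hy).le), Complex.ofReal_re]
    rw [hnorm y hy, h2, ← dist_eq_norm, ← hpd] at h1
    have h3 := infDist_le_deltaDom D hy
    have h4 : 0 < c * (deriv B y).re := mul_pos hc0 (hpos y hy)
    calc _ ≤ _ := h1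
      _ ≤ c * (deriv B y).re * deltaDom D := by gcongr
      _ = _ := by rw [hCdef]; ring
  have hlt : ∀ y ∈ Icc (-1 : ℝ) 1, |(B y).re| < 1 := fun y hy =>
    (Complex.abs_re_le_norm _).trans_lt (mem_ball_zero_iff.mp (hB.mapsTo (hseg y hy)))
  have hβx : (B x).re = 0 := by rw [hBx, Complex.zero_re]
  intro t ht
  rcases le_total x t with hxt | htx
  · have hsub : Icc x t ⊆ Icc (-1 : ℝ) 1 := Icc_subset_Icc hx.1 ht.2
    rw [abs_of_nonneg (sub_nonneg.mpr hxt)]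
    refine le_trans ?_ (le_abs_self _)
    exact div_add_le_of_one_sub_sq_le (β := fun t : ℝ => (B t).re) hC hxt
      (fun y hy => hβ y (hsub hy)) hβx
      (fun y hy => (abs_lt.mp (hlt y (hsub hy))).2) (fun y hy => hpos y (hsub hy))
      (fun y hy => hspeed y (hsub hy))
  · have hsub : ∀ y ∈ Icc (-x) (-t), -y ∈ Icc (-1 : ℝ) 1 := fun y hy =>
      ⟨by linarith [hy.2, ht.1], by linarith [hy.1, hx.2]⟩
    -- To the left of `x`, the growth bound is used for the reflected function `y ↦ -B (-y)`.
    have key := div_add_le_of_one_sub_sq_le (β := fun y : ℝ => -(B ((-y : ℝ) : ℂ)).re)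
      (β' := fun y : ℝ => (deriv B ((-y : ℝ) : ℂ)).re) (x := -x) (t := -t) hC (by linarith)
      (fun y hy => by
        have := ((hβ (-y) (hsub y hy)).comp y (hasDerivAt_neg y)).neg
        convert! this using 1
        ring)
      (by simp [hBx])
      (fun y hy => by linarith [(abs_lt.mp (hlt _ (hsub y hy))).1])
      (fun y hy => hpos _ (hsub y hy))
      (fun y hy => by rw [neg_sq]; exact hspeed _ (hsub y hy))
    simp only [neg_neg] at key
    rw [abs_of_nonpos (sub_nonpos.mpr htx), show -(t - x) = -t - -x by ring]
    exact key.trans (neg_le_abs _)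

/-! ### Logarithmic integrals and the Jensen step. -/

theorem intervalIntegrable_log_add_abs {C : ℝ} (hC : 0 < C) (x a b : ℝ) :
    IntervalIntegrable (fun t => Real.log (C + |t - x|)) volume a b := by
  refine Continuous.intervalIntegrable ?_ a b
  exact Continuous.log (by fun_prop) fun t => (by positivity)

theorem intervalIntegrable_log_sub (x a b : ℝ) :
    IntervalIntegrable (fun t => Real.log (t - x)) volume a b := by
  have := (intervalIntegral.intervalIntegrable_log' (a := a - x) (b := b - x)).comp_sub_right x
  simpa using this

/-- Convexity of `s log s` at the points `1` and `a` with weights `C / (C + 1)` and `1 / (C + 1)`.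
-/
theorem sub_le_mul_log {C a : ℝ} (hC : 0 < C) (ha : 0 ≤ a) :
    (C + a) * Real.log (C + a) - (C + a) * Real.log (C + 1) ≤ a * Real.log a := by
  have hw : C / (C + 1) + 1 / (C + 1) = 1 := by field_simp
  have h := Real.convexOn_mul_log.2 (show (1 : ℝ) ∈ Ici 0 by simp) (show a ∈ Ici 0 from ha)
    (show 0 ≤ C / (C + 1) by positivity) (show 0 ≤ 1 / (C + 1) by positivity) hw
  simp only [smul_eq_mul, Real.log_one, mul_one, mul_zero, zero_add] at h
  have e : C / (C + 1) + 1 / (C + 1) * a = (C + a) / (C + 1) := by ring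
  rw [e, Real.log_div (by positivity) (by positivity), div_mul_eq_mul_div, one_div_mul_eq_div,
    div_le_div_iff_of_pos_right (by positivity)] at h
  linarith

/-- The integral is explicit, `Real.log (t - x)` being `log |t - x|`. Adding `sub_le_mul_log` for `a
= 1 - x` and `a = 1 + x` cancels the dependence on `x`; equality holds at `x = 0`. -/
theorem integral_log_sub_log_ge {C x : ℝ} (hC : 0 < C) (hx : x ∈ Icc (-1 : ℝ) 1) :
    2 * (C * Real.log C - (C + 1) * Real.log (C + 1)) ≤
      ∫ t in (-1 : ℝ)..1, (Real.log (t - x) - Real.log (C + |t - x|)) := by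
  rw [intervalIntegral.integral_sub (intervalIntegrable_log_sub x _ _)
    (intervalIntegrable_log_add_abs hC x _ _),
    intervalIntegral.integral_comp_sub_right (fun t => Real.log t) x, integral_log,
    ← intervalIntegral.integral_add_adjacent_intervals
      (intervalIntegrable_log_add_abs hC x (-1) x) (intervalIntegrable_log_add_abs hC x x 1)]
  have h1 : ∫ t in (-1 : ℝ)..x, Real.log (C + |t - x|) = ∫ t in C..(C + x + 1), Real.log t := by
    have : ∫ t in (-1 : ℝ)..x, Real.log (C + |t - x|) = ∫ t in (-1 : ℝ)..x, Real.log (C + x - t) := by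
      refine intervalIntegral.integral_congr fun t ht => ?_
      rw [uIcc_of_le hx.1] at ht
      rw [abs_of_nonpos (by linarith [ht.2])]
      congr 1; ring
    rw [this, intervalIntegral.integral_comp_sub_left (fun t => Real.log t) (C + x)]
    congr 1 <;> ring
  have h2 : ∫ t in x..1, Real.log (C + |t - x|) = ∫ t in C..(C + 1 - x), Real.log t := by
    have : ∫ t in x..1, Real.log (C + |t - x|) = ∫ t in x..1, Real.log (t - (x - C)) := by
      refine intervalIntegral.integral_congr fun t ht => ?_
      rw [uIcc_of_le hx.2] at ht
      rw [abs_of_nonneg (by linarith [ht.1])]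
      congr 1; ring
    rw [this, intervalIntegral.integral_comp_sub_right (fun t => Real.log t) (x - C)]
    congr 1 <;> ring
  rw [h1, h2, integral_log, integral_log, show (-1 - x) = -(1 + x) by ring, Real.log_neg_eq_log]
  have k1 := sub_le_mul_log hC (show 0 ≤ 1 - x by linarith [hx.2])
  have k2 := sub_le_mul_log hC (show 0 ≤ 1 + x by linarith [hx.1])
  rw [show C + (1 - x) = C + 1 - x by ring] at k1
  rw [show C + (1 + x) = C + x + 1 by ring] at k2
  linarith

/-- The Jensen-type lower bound for the integral of a function dominating a product. -/
theorem two_mul_exp_le_integral {n N : ℕ} {x : Fin n → ℝ} {k : Fin n → ℕ} (hk : ∑ j, k j = N)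
    (hx : ∀ j, x j ∈ Icc (-1 : ℝ) 1) {C : ℝ} (hC : 0 < C) {G : ℝ → ℝ}
    (hG : ContinuousOn G (Icc (-1) 1))
    (hle : ∀ t ∈ Icc (-1 : ℝ) 1, ∏ j, (|t - x j| / (C + |t - x j|)) ^ (2 * k j) ≤ G t) :
    2 * Real.exp (2 * N * (C * Real.log C - (C + 1) * Real.log (C + 1))) ≤
      ∫ t in (-1 : ℝ)..1, G t := by
  set m := C * Real.log C - (C + 1) * Real.log (C + 1) with hm
  -- `M` is a lower bound for the mean over `[-1,1]` of the logarithm of the product. The tangent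
  -- inequality `exp u ≥ exp M * (1 + u - M)` then integrates to at least `2 * exp M`.
  set M := 2 * N * m with hM
  set h : Fin n → ℝ → ℝ := fun j t => Real.log (t - x j) - Real.log (C + |t - x j|) with hh
  have hhi : ∀ j, IntervalIntegrable (fun t => (2 * k j : ℝ) * h j t) volume (-1) 1 := fun j =>
    ((intervalIntegrable_log_sub _ _ _).sub (intervalIntegrable_log_add_abs hC _ _ _)).const_mul _
  have hsumi : IntervalIntegrable (fun t => ∑ j, (2 * k j : ℝ) * h j t) volume (-1) 1 := by
    have := IntervalIntegrable.sum (μ := volume) (a := (-1 : ℝ)) (b := 1) Finset.univ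
      (f := fun j t => (2 * k j : ℝ) * h j t) fun j _ => hhi j
    convert! this using 1
    ext t; simp
  have hint : IntervalIntegrable
      (fun t => Real.exp M * ((1 - M) + ∑ j, (2 * k j : ℝ) * h j t)) volume (-1) 1 :=
    (intervalIntegrable_const.add hsumi).const_mul _
  have hGi : IntervalIntegrable G volume (-1) 1 :=
    ContinuousOn.intervalIntegrable (by rwa [uIcc_of_le (by norm_num)])
  have hmono : ∫ t in (-1 : ℝ)..1, Real.exp M * ((1 - M) + ∑ j, (2 * k j : ℝ) * h j t)
      ≤ ∫ t in (-1 : ℝ)..1, G t := by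
    refine intervalIntegral.integral_mono_ae_restrict (by norm_num) hint hGi ?_
    -- The nodes are excluded because `Real.log 0 = 0` breaks the exponential form of the product
    -- there.
    have hae : ∀ᵐ t : ℝ, t ∉ range x :=
      measure_eq_zero_iff_ae_notMem.mp ((finite_range x).measure_zero volume)
    filter_upwards [ae_restrict_mem measurableSet_Icc, ae_restrict_of_ae hae] with t ht htx
    refine le_trans ?_ (hle t ht)
    have hprod : ∏ j, (|t - x j| / (C + |t - x j|)) ^ (2 * k j)
        = Real.exp (∑ j, (2 * k j : ℝ) * h j t) := by
      rw [Real.exp_sum]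
      refine Finset.prod_congr rfl fun j _ => ?_
      have hpos : 0 < |t - x j| := abs_pos.mpr (sub_ne_zero.mpr fun e => htx ⟨j, e.symm⟩)
      rw [hh]
      simp only
      rw [← Real.log_abs (t - x j), ← Real.log_div hpos.ne' (by positivity),
        show (2 * k j : ℝ) = ((2 * k j : ℕ) : ℝ) by push_cast; ring, ← Real.log_pow,
        Real.exp_log (by positivity)]
    rw [hprod]
    set u := ∑ j, (2 * k j : ℝ) * h j t
    have : Real.exp u = Real.exp M * Real.exp (u - M) := by rw [← Real.exp_add]; congr 1; ring
    rw [this]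
    have := Real.add_one_le_exp (u - M)
    gcongr
    linarith
  refine le_trans ?_ hmono
  rw [intervalIntegral.integral_const_mul, intervalIntegral.integral_add intervalIntegrable_const
    hsumi, intervalIntegral.integral_const, intervalIntegral.integral_finsetSum fun j _ => hhi j]
  simp only [intervalIntegral.integral_const_mul]
  have hs : 2 * M ≤ ∑ j, (2 * k j : ℝ) * ∫ t in (-1 : ℝ)..1, h j t := by
    calc 2 * M = ∑ j, (2 * k j : ℝ) * (2 * m) := by
          rw [← Finset.sum_mul, ← Finset.mul_sum, hM, ← hk]; push_cast; ring
      _ ≤ _ := Finset.sum_le_sum fun j _ => by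
          gcongr
          exact integral_log_sub_log_ge hC (hx j)
  rw [smul_eq_mul, mul_comm]
  gcongr
  linarith

/-! ### The competitor and the bound for `jPlus`. -/

theorem two_mul_exp_le_jPlusNodes {D : Set ℂ} (hD : IsNiceDomain D) (hne : D ≠ univ)
    (hseg : ∀ t : ℝ, t ∈ Icc (-1 : ℝ) 1 → (t : ℂ) ∈ D) {c : ℝ} (hc0 : 0 < c)
    (hc : KoebeBound D c) {n N : ℕ} (hN : 0 < N) {x : Fin n → ℝ} {k : Fin n → ℕ}
    (hx : ∀ j, x j ∈ Icc (-1 : ℝ) 1) (hk0 : ∀ j, 0 < k j) (hk : ∑ j, k j = N) :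
    2 * Real.exp (2 * N * (c * deltaDom D * Real.log (c * deltaDom D)
      - (c * deltaDom D + 1) * Real.log (c * deltaDom D + 1))) ≤ jPlusNodes volume D x k := by
  have hδ : 0 < deltaDom D := deltaDom_pos hD.isOpen hne (by simpa using hseg 0 (by simp))
  choose B hBd hBm hBx hBr hBl using fun j =>
    hD.exists_map_lower_bound hne hseg hc0 hc (hx j)
  set g : ℂ → ℂ := fun z => ∏ j, B j z ^ (2 * k j) with hg
  set G : ℝ → ℝ := fun t => ∏ j, (B j t).re ^ (2 * k j) with hGdef
  have hgG : ∀ t : ℝ, (t : ℂ) ∈ D → g t = (G t : ℂ) := by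
    intro t ht
    simp only [hg, hGdef]
    push_cast
    refine Finset.prod_congr rfl fun j _ => ?_
    rw [Complex.ext (z := B j t) (w := ((B j t).re : ℂ)) rfl (by simp [hBr j t ht]),
      Complex.ofReal_re]
  have hGnn : ∀ t, 0 ≤ G t := fun t => Finset.prod_nonneg fun j _ => by
    rw [pow_mul]; positivity
  have hgd : DifferentiableOn ℂ g D := by
    have := DifferentiableOn.fun_finsetProd (𝕜 := ℂ) (s := D) (u := Finset.univ)
      (f := fun j z => B j z ^ (2 * k j)) fun j _ => (hBd j).pow _
    exact this
  have hgm : MapsTo g D (ball 0 1) := by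
    intro z hz
    rw [mem_ball_zero_iff, hg, norm_prod]
    -- `N > 0` rules out the empty product, whose value `1` is not in the open disc.
    have hn : (Finset.univ : Finset (Fin n)).Nonempty := by
      by_contra h
      rw [Finset.not_nonempty_iff_eq_empty] at h
      rw [h, Finset.sum_empty] at hk
      omega
    obtain ⟨i, -⟩ := hn
    rw [← Finset.mul_prod_erase _ _ (Finset.mem_univ i)]
    have hle : ∀ j, ‖B j z ^ (2 * k j)‖ < 1 := fun j => by
      rw [norm_pow]
      exact pow_lt_one₀ (norm_nonneg _) (mem_ball_zero_iff.mp (hBm j hz))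
        (by have := hk0 j; omega)
    exact mul_lt_one_of_nonneg_of_lt_one_left (norm_nonneg _) (hle i)
      (Finset.prod_le_one (fun j _ => norm_nonneg _) fun j _ => (hle j).le)
  have hgz : ∀ j, ∀ l < k j, iteratedDeriv l g (x j : ℂ) = 0 := by
    intro j
    have hxD := hD.isOpen.mem_nhds (hseg _ (hx j))
    have hga : AnalyticAt ℂ g (x j) := hgd.analyticAt hxD
    rw [← natCast_le_analyticOrderAt_iff_iteratedDeriv_eq_zero hga]
    have hBa : ∀ i, AnalyticAt ℂ (B i) (x j) := fun i => (hBd i).analyticAt hxD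
    have hsplit : g = (B j ^ (2 * k j)) *
        fun z => ∏ i ∈ Finset.univ.erase j, B i z ^ (2 * k i) := by
      ext z
      simp only [hg, Pi.mul_apply, Pi.pow_apply]
      exact (Finset.mul_prod_erase _ _ (Finset.mem_univ j)).symm
    have hrest : AnalyticAt ℂ (fun z => ∏ i ∈ Finset.univ.erase j, B i z ^ (2 * k i)) (x j) :=
      Finset.analyticAt_fun_prod _ fun i _ => (hBa i).pow _
    rw [hsplit, analyticOrderAt_mul ((hBa j).pow _) hrest, analyticOrderAt_pow (hBa j)]
    have h1 : 1 ≤ analyticOrderAt (B j) (x j) := by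
      rw [Order.one_le_iff_ne_zero, (hBa j).analyticOrderAt_ne_zero]; exact hBx j
    calc (k j : ℕ∞) ≤ (2 * k j : ℕ) := by exact_mod_cast (by omega)
      _ = (2 * k j) • (1 : ℕ∞) := by simp
      _ ≤ (2 * k j) • analyticOrderAt (B j) (x j) := by gcongr
      _ ≤ _ := le_self_add
  have hgpos : g ∈ posFamily D x k := by
    refine ⟨⟨⟨hgd, hgm, hgz⟩, fun t ht => ?_⟩, fun t ht => ?_⟩
    · rw [hgG t ht, Complex.ofReal_im]
    · rw [hgG t ht, Complex.ofReal_re]; exact hGnn t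
  -- Boundedness is needed because a real `sSup` of an unbounded set is `0`.
  have hbdd : BddAbove
      ((fun g : ℂ → ℂ => ‖∫ t in Icc (-1 : ℝ) 1, g (t : ℂ)‖) '' posFamily D x k) := by
    refine ⟨1 * (volume : Measure ℝ).real (Icc (-1 : ℝ) 1), ?_⟩
    rintro _ ⟨f, hf, rfl⟩
    exact norm_setIntegral_le_of_norm_le_const (by simp) fun t ht =>
      (mem_ball_zero_iff.mp (hf.1.1.2.1 (hseg t ht))).le
  refine le_trans ?_ (le_csSup hbdd ⟨g, hgpos, rfl⟩)
  have hGc : ContinuousOn G (Icc (-1) 1) := by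
    refine continuousOn_finsetProd _ fun j _ => ContinuousOn.pow ?_ _
    exact Complex.continuous_re.comp_continuousOn
      ((hBd j).continuousOn.comp Complex.continuous_ofReal.continuousOn hseg)
  have hval : ∫ t in Icc (-1 : ℝ) 1, g (t : ℂ) = ((∫ t in (-1 : ℝ)..1, G t : ℝ) : ℂ) := by
    rw [intervalIntegral.integral_of_le (by norm_num), ← integral_Icc_eq_integral_Ioc,
      ← integral_complex_ofReal]
    exact setIntegral_congr_fun measurableSet_Icc fun t ht => hgG t (hseg t ht)
  simp only [hval, Complex.norm_real]
  refine le_trans ?_ (le_abs_self _)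
  refine two_mul_exp_le_integral hk hx (mul_pos hc0 hδ) hGc fun t ht => ?_
  refine Finset.prod_le_prod (fun j _ => by positivity) fun j _ => ?_
  rw [← (even_two_mul (k j)).pow_abs (B j t).re]
  exact pow_le_pow_left₀ (by positivity) (hBl j t ht) _

end

theorem two_mul_exp_le_jPlus {D : Set ℂ} (hD : IsNiceDomain D) (hne : D ≠ univ)
    (hseg : ∀ t : ℝ, t ∈ Icc (-1 : ℝ) 1 → (t : ℂ) ∈ D) {c : ℝ} (hc0 : 0 < c)
    (hc : KoebeBound D c) {N : ℕ} (hN : 0 < N) :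
    2 * Real.exp (2 * N * (c * deltaDom D * Real.log (c * deltaDom D)
      - (c * deltaDom D + 1) * Real.log (c * deltaDom D + 1))) ≤ jPlus volume D N := by
  -- A single node at `0` of multiplicity `N` shows that the infimum is over a nonempty set.
  refine le_csInf ⟨_, 1, fun _ => 0, fun _ => N, Subsingleton.strictMono _, by simp,
    fun _ => hN, by simp, rfl⟩ ?_
  rintro _ ⟨n, x, k, -, hx, hk0, hk, rfl⟩
  exact two_mul_exp_le_jPlusNodes hD hne hseg hc0 hc hN hx hk0 hk

/-! ### Closed forms of the bound. -/

theorem two_mul_pow_mul_rpow_div_eq {δ L : ℝ} (hδ : 0 < δ) (hL : 0 < L) (N : ℕ) :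
    2 * L ^ (2 * N) * (δ ^ (2 * N * δ / L) / (δ + L) ^ (2 * N / L * (δ + L))) =
      2 * Real.exp (2 * N * (L⁻¹ * δ * Real.log (L⁻¹ * δ)
        - (L⁻¹ * δ + 1) * Real.log (L⁻¹ * δ + 1))) := by
  have h1 : L⁻¹ * δ + 1 = (δ + L) / L := by field_simp
  rw [h1, Real.rpow_def_of_pos hδ, Real.rpow_def_of_pos (by positivity), ← Real.exp_sub,
    ← Real.rpow_natCast, Real.rpow_def_of_pos hL, mul_assoc, ← Real.exp_add,
    Real.log_div (by positivity) hL.ne', Real.log_mul (by positivity) hδ.ne', Real.log_inv]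
  congr 2
  push_cast
  field_simp
  ring

theorem two_mul_half_pow_eq {δ : ℝ} (hδ : 0 < δ) (N : ℕ) :
    2 * (1 / 2 : ℝ) ^ (2 * N) *
        (δ ^ (2 * N * δ / (1 / 2)) / (δ + 1 / 2) ^ (2 * N / (1 / 2) * (δ + 1 / 2))) =
      2 * ((1 + 1 / (2 * δ)) ^ (2 * δ) * (2 * δ + 1)) ^ (-2 * N : ℝ) := by
  have h1 : (1 + 1 / (2 * δ)) = (2 * δ + 1) / (2 * δ) := by field_simp
  have h2 : (0 : ℝ) < (1 + 1 / (2 * δ)) ^ (2 * δ) := by positivity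
  rw [two_mul_pow_mul_rpow_div_eq hδ (by norm_num), Real.rpow_def_of_pos (by positivity),
    Real.log_mul h2.ne' (by positivity), Real.log_rpow (by positivity), h1,
    Real.log_div (by positivity) (by positivity)]
  congr 2
  norm_num
  ring

/-- From `log (1 + s) ≤ s` the first factor of the base is at most `e`; the exponent `-2 * N`
reverses the inequality. -/
theorem exp_mul_le_rpow {δ : ℝ} (hδ : 0 < δ) (N : ℕ) :
    2 * Real.exp (-2 * N) * (2 * δ + 1) ^ (-2 * N : ℝ) ≤
      2 * ((1 + 1 / (2 * δ)) ^ (2 * δ) * (2 * δ + 1)) ^ (-2 * N : ℝ) := by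
  have h2 : (0 : ℝ) < (1 + 1 / (2 * δ)) ^ (2 * δ) := by positivity
  have h3 : (1 + 1 / (2 * δ)) ^ (2 * δ) ≤ Real.exp 1 := by
    rw [Real.rpow_def_of_pos (by positivity)]
    refine Real.exp_le_exp.mpr ?_
    have := Real.log_le_sub_one_of_pos (show (0 : ℝ) < 1 + 1 / (2 * δ) by positivity)
    calc Real.log (1 + 1 / (2 * δ)) * (2 * δ) ≤ (1 / (2 * δ)) * (2 * δ) := by
          gcongr; linarith
      _ = 1 := by field_simp
  rw [Real.mul_rpow h2.le (by positivity), mul_assoc]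
  gcongr
  calc Real.exp (-2 * N) = Real.exp 1 ^ (-2 * N : ℝ) := by rw [← Real.exp_mul, one_mul]
    _ ≤ _ := Real.rpow_le_rpow_of_nonpos h2 h3 (by
      have : (0 : ℝ) ≤ N := N.cast_nonneg
      linarith)

theorem mainTheorem3 (D : Set ℂ) (hD : IsNiceDomain D) (hne : D ≠ Set.univ)
    (hseg : ∀ t : ℝ, t ∈ Set.Icc (-1 : ℝ) 1 → (t : ℂ) ∈ D) (N : ℕ) (hN : 0 < N) :
    (∀ L : ℝ, (L = 1 / 4 ∨ (Convex ℝ D ∧ L = 1 / 2)) →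
      2 * L ^ (2 * N) *
          (deltaDom D ^ (2 * N * deltaDom D / L) /
            (deltaDom D + L) ^ (2 * N / L * (deltaDom D + L)))
        ≤ jPlus volume D N) ∧
    (Convex ℝ D →
      2 * ((1 + 1 / (2 * deltaDom D)) ^ (2 * deltaDom D) * (2 * deltaDom D + 1)) ^ (-2 * N : ℝ)
          ≤ jPlus volume D N ∧
        2 * Real.exp (-2 * N) * (2 * deltaDom D + 1) ^ (-2 * N : ℝ)
          ≤ 2 * ((1 + 1 / (2 * deltaDom D)) ^ (2 * deltaDom D) *
              (2 * deltaDom D + 1)) ^ (-2 * N : ℝ)) := by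
  have hδ : 0 < deltaDom D := deltaDom_pos hD.isOpen hne (by simpa using hseg 0 (by simp))
  have hmain : ∀ L : ℝ, (L = 1 / 4 ∨ (Convex ℝ D ∧ L = 1 / 2)) →
      2 * L ^ (2 * N) *
          (deltaDom D ^ (2 * N * deltaDom D / L) /
            (deltaDom D + L) ^ (2 * N / L * (deltaDom D + L)))
        ≤ jPlus volume D N := by
    intro L hL
    have hL0 : 0 < L := by
      rcases hL with rfl | ⟨-, rfl⟩ <;> norm_num
    have hK : KoebeBound D L⁻¹ := by
      rcases hL with rfl | ⟨hconv, rfl⟩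
      · simpa using koebeBound_four D
      · simpa using koebeBound_two_of_convex hD.isOpen hconv
    rw [two_mul_pow_mul_rpow_div_eq hδ hL0]
    exact two_mul_exp_le_jPlus hD hne hseg (inv_pos.mpr hL0) hK hN
  refine ⟨hmain, fun hconv => ⟨?_, exp_mul_le_rpow hδ N⟩⟩
  rw [← two_mul_half_pow_eq hδ]
  exact hmain _ (Or.inr ⟨hconv, rfl⟩)
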